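/- **Theorem 1.** $\mathrm{P/poly}\subseteq\mathrm{BPP/samp}$, and hence $\mathrm{P/poly}=\mathrm{BPP/samp}$. Here $\mathrm{P/poly}$ is the class of languages $L\subseteq\{0,1\}^*$ for which there are a deterministic Turing machine $M$ running in polynomial time and a sequence of advice strings $(a_n)_{n\in\mathbb N}$, with the length of $a_n$ bounded by a polynomial in $n$, such that $M(x,a_{\ell(x)})=\mathbb 1\{x\in L\}$ for every binary string $x$, where $\ell(x)$ is the length of $x$. $\mathrm{BPP/samp}$ is the class of languages $L\subseteq\{0,1\}^*$ for which there are a probabilistic Turing machine $M$ running in polynomial time, a sequence of probability distributions $(D_n)_{n\in\mathbb N}$ with $D_n$ supported on $\{0,1\}^n$, and a polynomial $p$, such that for every binary string $x$ $$\mathbb P\big(M(x,\mathcal T_{p(\ell(x))})=\mathbb 1\{x\in L\}\big)\ge \tfrac23,$$ where $\mathcal T_{p(n)}=\{(x_i,\mathbb 1\{x_i\in L\})\}_{i=1}^{p(n)}$ with $x_1,\dots,x_{p(n)}$ drawn independently from $D_n$, and the probability is over both the training set and the internal randomness of $M$. -/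

import Mathlib

open MeasureTheory Turing

namespace SamplingAdvice

/-! ### Probabilistic Turing machines -/

/-- A probabilistic Turing machine: a (multi-stack) Turing machine with two transition programs.
At every step a fair coin decides which of the two programs is applied. -/
structure ProbTM extends FinTM2 where
  /-- the program that is applied when the coin shows `true`;
  the program `m` of the underlying machine is applied when the coin shows `false` -/
  mTrue : Λ → TM2.Stmt Γ Λ σ

namespace ProbTM

variable (M : ProbTM)

/-- One step of the machine, when the coin shows `b`; it is `none` on halted configurations. -/
def coinStep (b : Bool) : M.toFinTM2.Cfg → Option M.toFinTM2.Cfg :=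
  TM2.step (fun l => if b then M.mTrue l else M.m l)

/-- The configuration after exactly `t` steps from `c`, where the `i`-th step uses the coin `r i`
(`none` if the machine has halted before). -/
def run (r : ℕ → Bool) (c : M.toFinTM2.Cfg) : ℕ → Option M.toFinTM2.Cfg
  | 0 => some c
  | t + 1 => (run r c t).bind (M.coinStep (r t))

/-- With the coin tosses `r` and the input `l`, the machine halts with the output `l'` after at
most `T` steps. -/
def OutputsInTime (r : ℕ → Bool) (l : List (M.Γ M.k₀)) (l' : List (M.Γ M.k₁)) (T : ℕ) : Prop :=
  ∃ t ≤ T, M.run r (initList M.toFinTM2 l) t = some (haltList M.toFinTM2 l')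

end ProbTM

/-- `f a r` is computed from the (encoded) input `a` by a probabilistic Turing machine with coin
tosses `r`, which halts on every input, for every outcome of the coins, after a number of steps that
is at most a fixed polynomial in the length of the input. -/
def ProbComputableInPolyTime {α β αΓ βΓ : Type} (ea : α → List αΓ) (eb : β → List βΓ)
    (f : α → (ℕ → Bool) → β) : Prop :=
  ∃ (M : ProbTM) (inputAlphabet : M.Γ M.k₀ ≃ αΓ) (outputAlphabet : M.Γ M.k₁ ≃ βΓ)
    (time : Polynomial ℕ), ∀ (a : α) (r : ℕ → Bool),
      M.OutputsInTime r ((ea a).map inputAlphabet.symm) ((eb (f a r)).map outputAlphabet.symm)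
        (time.eval (ea a).length)

/-! ### Encodings of the inputs, over the alphabet `{0, 1, #}`, where `#` is `none` -/

/-- The input `(x, a)` is written `x # a`. -/
def encodePair (z : List Bool × List Bool) : List (Option Bool) :=
  z.1.map some ++ none :: z.2.map some

/-- A labelled example `(y, b)` is written `y # b #`. -/
def encodeExample (e : List Bool × Bool) : List (Option Bool) :=
  e.1.map some ++ [none, some e.2, none]

/-- The input `(x, [e₁, …, eₘ])` is written `x # e₁ ⋯ eₘ`. -/
def encodeWithExamples (z : List Bool × List (List Bool × Bool)) : List (Option Bool) :=
  z.1.map some ++ none :: z.2.flatMap encodeExample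

/-! ### The complexity classes -/

open Classical in
/-- The indicator of membership in the language `L`. -/
noncomputable def indicator (L : Language Bool) (x : List Bool) : Bool :=
  decide (x ∈ L)

/-- **P/poly**: the languages decided by a deterministic polynomial-time Turing machine with an
advice string of polynomial length that depends only on the length of the input. -/
def PPoly : Set (Language Bool) :=
  {L | ∃ f : List Bool × List Bool → Bool,
    Nonempty (TM2ComputableInPolyTime encodePair Computability.encodeBool f) ∧
    ∃ (a : ℕ → List Bool) (q : Polynomial ℕ), (∀ n, (a n).length ≤ q.eval n) ∧
      ∀ x : List Bool, f (x, a x.length) = indicator L x}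

/-- The training set that belongs to the sample points `s 0, …, s (m - 1)`: every point comes with
its label. -/
noncomputable def trainingSet (L : Language Bool) {n m : ℕ} (s : Fin m → Fin n → Bool) :
    List (List Bool × Bool) :=
  List.ofFn fun i => (List.ofFn (s i), indicator L (List.ofFn (s i)))

/-- The law of `m` independent samples from `D`. -/
noncomputable def sampleLaw {n : ℕ} (D : PMF (Fin n → Bool)) (m : ℕ) :
    Measure (Fin m → Fin n → Bool) :=
  Measure.pi fun _ => D.toMeasure

/-- The law of a sequence of independent fair coin tosses. -/
noncomputable def coinLaw : Measure (ℕ → Bool) :=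
  Measure.infinitePi fun _ => (PMF.uniformOfFintype Bool).toMeasure

/-- **BPP/samp**: the languages decided with probability at least `2/3` by a probabilistic
polynomial-time Turing machine that is given, besides the input `x`, polynomially many labelled
examples drawn independently from a distribution that depends only on the length of `x`. The
probability is over the examples and the (independent) coin tosses of the machine. -/
def BPPSamp : Set (Language Bool) :=
  {L | ∃ f : List Bool × List (List Bool × Bool) → (ℕ → Bool) → Bool,
    ProbComputableInPolyTime encodeWithExamples Computability.encodeBool f ∧
    ∃ (D : (n : ℕ) → PMF (Fin n → Bool)) (p : Polynomial ℕ), ∀ x : List Bool,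
      2 / 3 ≤ ((sampleLaw (D x.length) (p.eval x.length)).prod coinLaw)
        {ω | f (x, trainingSet L ω.1) ω.2 = indicator L x}}

end SamplingAdvice

/-! For P/poly ⊆ BPP/samp the advice is hidden in the support of the sampling distribution; labels
and coins play no role. A word of length `n` has room for one bit and an index of `n - 1` binary
digits. Let `M = q(n) + 1`, where `q` bounds the advice length, and let `D n` be uniform on `M`
codewords, the `j`-th being bit `j` of the advice followed by the index `j`; codewords beyond the
end of the advice carry the index `M`, which is never asked for. The indices fit once `q(n) + 1 < 2
^ (n - 1)`, so for all but finitely many `n`; shorter words are decided by a finite automaton.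

The `M * B` samples, with `B = 3 * M ^ 2`, are cut into `M` blocks. Block `j` misses codeword `j`
with probability at most `(1 - 1/M) ^ B ≤ exp (-3M) ≤ 1/(3M)`, so by a union bound every block
contains its codeword with probability at least 2/3 (`le_sampleLaw_hit`). Then one scan suffices: a
binary counter is compared with each index, and on a match the bit is stored and the counter
incremented. By the end of block `j` the counter has passed `j` (`le_progress`), and the whole
advice has been gathered in order (`foldl_gather_trainingSet`). `gatherFun_computable` carries this
out on a Turing machine.

The converse is Adleman's argument. The advice lists `12 * (n + 1)` runs, each given by a labelled
training set and the finitely many coins that matter. The runs are chosen one after another so that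
the sum over all `x` of `2 ^ (number of wrong runs on x)` grows by a factor of at most 4/3 each
time; in the end no `x` can have half of its runs wrong (`exists_list_majority`). A deterministic
machine simulates the runs and takes the majority (`majorityOfRuns_computable`). -/

namespace SamplingAdvice

/-! ### Reaching a configuration within a number of steps -/

section Steps

variable {C : Type*} {f : C → Option C} {a b c : C} {m n : ℕ}

/-- Iterating the partial function `f` exactly `n` times leads from `a` to `b`. -/
def StepsIn (f : C → Option C) : ℕ → C → C → Prop
  | 0, a, b => a = b
  | n + 1, a, b => ∃ c, f a = some c ∧ StepsIn f n c b

theorem StepsIn.trans (h₁ : StepsIn f m a b) (h₂ : StepsIn f n b c) : StepsIn f (m + n) a c := by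
  induction m generalizing a with
  | zero => cases h₁; simpa using h₂
  | succ m ih =>
    obtain ⟨d, hd, h⟩ := h₁
    rw [Nat.succ_add]
    exact ⟨d, hd, ih h⟩

theorem StepsIn.single (h : f a = some b) : StepsIn f 1 a b := ⟨b, h, rfl⟩

theorem stepsIn_iff_iterate :
    StepsIn f n a b ↔ (flip bind f)^[n] (some a : Option C) = some b := by
  induction n generalizing a with
  | zero => simp [StepsIn]
  | succ n ih =>
    rw [Function.iterate_succ_apply]
    cases h : f a with
    | none =>
      have : flip bind f (some a : Option C) = none := h
      have hn : ∀ k, (flip bind f)^[k] (none : Option C) = none := by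
        intro k
        induction k with
        | zero => rfl
        | succ k ihk => rw [Function.iterate_succ_apply]; exact ihk
      rw [this, hn]
      simp [StepsIn, h]
    | some d =>
      have : flip bind f (some a : Option C) = some d := h
      rw [this, ← ih]
      simp [StepsIn, h]

/-- Iterating `f` at most `n` times leads from `a` to `b`. -/
def Within (f : C → Option C) (n : ℕ) (a b : C) : Prop := ∃ t ≤ n, StepsIn f t a b

theorem Within.refl : Within f n a a := ⟨0, n.zero_le, rfl⟩

theorem Within.trans (h₁ : Within f m a b) (h₂ : Within f n b c) : Within f (m + n) a c := by
  obtain ⟨s, hs, h₁⟩ := h₁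
  obtain ⟨t, ht, h₂⟩ := h₂
  exact ⟨s + t, add_le_add hs ht, h₁.trans h₂⟩

theorem Within.mono (h : Within f m a b) (hmn : m ≤ n) : Within f n a b := by
  obtain ⟨s, hs, h⟩ := h
  exact ⟨s, hs.trans hmn, h⟩

theorem Within.head (h : f a = some b) (h' : Within f n b c) : Within f (n + 1) a c := by
  rw [add_comm]
  exact Within.trans ⟨1, le_rfl, .single h⟩ h'

theorem Within.single (h : f a = some b) : Within f 1 a b := ⟨1, le_rfl, .single h⟩

/-- Translates Mathlib's data-valued time bounds into propositions whose costs add up under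
`Within.trans`. -/
theorem within_iff_nonempty_evalsToInTime :
    Within f n a b ↔ Nonempty (StateTransition.EvalsToInTime f a (some b) n) := by
  constructor
  · rintro ⟨t, ht, h⟩
    exact ⟨⟨⟨t, stepsIn_iff_iterate.1 h⟩, ht⟩⟩
  · rintro ⟨⟨⟨t, h⟩, ht⟩⟩
    exact ⟨t, ht, stepsIn_iff_iterate.2 h⟩

end Steps

/-! ### Running one machine inside another

The larger machine has the stacks of the given one and additional stacks over the alphabet
`{0, 1, #}`. -/

section Lift

variable {K K₂ : Type} {Γ : K → Type} {Λ Λ₂ σ σ₂ : Type}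

/-- The alphabets of the stacks of the larger machine. -/
def Alphabet (K₂ : Type) (Γ : K → Type) : K ⊕ K₂ → Type
  | .inl k => Γ k
  | .inr _ => Option Bool

/-- The programs of the larger machine. -/
abbrev LargeStmt (K₂ : Type) (Γ : K → Type) (Λ Λ₂ σ σ₂ : Type) :=
  TM2.Stmt (Alphabet K₂ Γ) (Λ ⊕ Λ₂) (σ × σ₂)

/-- Push onto a stack of the given machine. -/
def pushL (k : K) (f : σ × σ₂ → Γ k) (q : LargeStmt K₂ Γ Λ Λ₂ σ σ₂) :
    LargeStmt K₂ Γ Λ Λ₂ σ σ₂ := .push (.inl k) f q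

/-- Look at the top of a stack of the given machine. -/
def peekL (k : K) (f : σ × σ₂ → Option (Γ k) → σ × σ₂) (q : LargeStmt K₂ Γ Λ Λ₂ σ σ₂) :
    LargeStmt K₂ Γ Λ Λ₂ σ σ₂ := .peek (.inl k) f q

/-- Pop from a stack of the given machine. -/
def popL (k : K) (f : σ × σ₂ → Option (Γ k) → σ × σ₂) (q : LargeStmt K₂ Γ Λ Λ₂ σ σ₂) :
    LargeStmt K₂ Γ Λ Λ₂ σ σ₂ := .pop (.inl k) f q

/-- Push onto an additional stack. -/
def pushR (k : K₂) (f : σ₂ → Option Bool) (q : LargeStmt K₂ Γ Λ Λ₂ σ σ₂) :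
    LargeStmt K₂ Γ Λ Λ₂ σ σ₂ := .push (.inr k) (fun v => f v.2) q

/-- Look at the top of an additional stack. -/
def peekR (k : K₂) (f : σ₂ → Option (Option Bool) → σ₂) (q : LargeStmt K₂ Γ Λ Λ₂ σ σ₂) :
    LargeStmt K₂ Γ Λ Λ₂ σ σ₂ := .peek (.inr k) (fun v s => (v.1, f v.2 s)) q

/-- Pop from an additional stack. -/
def popR (k : K₂) (f : σ₂ → Option (Option Bool) → σ₂) (q : LargeStmt K₂ Γ Λ Λ₂ σ σ₂) :
    LargeStmt K₂ Γ Λ Λ₂ σ σ₂ := .pop (.inr k) (fun v s => (v.1, f v.2 s)) q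

/-- Change the additional local variables. -/
def loadR (f : σ₂ → σ₂) (q : LargeStmt K₂ Γ Λ Λ₂ σ σ₂) :
    LargeStmt K₂ Γ Λ Λ₂ σ σ₂ := .load (fun v => (v.1, f v.2)) q

/-- Branch on the additional local variables. -/
def branchR (f : σ₂ → Bool) (q₁ q₂ : LargeStmt K₂ Γ Λ Λ₂ σ σ₂) :
    LargeStmt K₂ Γ Λ Λ₂ σ σ₂ := .branch (fun v => f v.2) q₁ q₂

/-- Jump to a label of the given machine. -/
def gotoL (l : Λ) : LargeStmt K₂ Γ Λ Λ₂ σ σ₂ := .goto fun _ => .inl l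

/-- Jump to an additional label. -/
def gotoR (l : Λ₂) : LargeStmt K₂ Γ Λ Λ₂ σ σ₂ := .goto fun _ => .inr l

/-- A program as a program of the larger machine, with `e` in place of `halt`. -/
def liftStmt (e : LargeStmt K₂ Γ Λ Λ₂ σ σ₂) : TM2.Stmt Γ Λ σ → LargeStmt K₂ Γ Λ Λ₂ σ σ₂
  | .push k f q => pushL k (fun v => f v.1) (liftStmt e q)
  | .peek k f q => peekL k (fun v s => (f v.1 s, v.2)) (liftStmt e q)
  | .pop k f q => popL k (fun v s => (f v.1 s, v.2)) (liftStmt e q)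
  | .load f q => .load (fun v => (f v.1, v.2)) (liftStmt e q)
  | .branch f q₁ q₂ => .branch (fun v => f v.1) (liftStmt e q₁) (liftStmt e q₂)
  | .goto l => .goto (fun v => .inl (l v.1))
  | .halt => e

/-- The stacks of the larger machine. -/
def joinStacks (S : ∀ k, List (Γ k)) (R : K₂ → List (Option Bool)) :
    ∀ k, List (Alphabet K₂ Γ k)
  | .inl k => S k
  | .inr k => R k

/-- A configuration of the larger machine. -/
def largeCfg (l : Option (Λ ⊕ Λ₂)) (v : σ) (w : σ₂) (S : ∀ k, List (Γ k))
    (R : K₂ → List (Option Bool)) : TM2.Cfg (Alphabet K₂ Γ) (Λ ⊕ Λ₂) (σ × σ₂) :=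
  ⟨l, (v, w), joinStacks S R⟩

variable [DecidableEq K] [DecidableEq K₂]

theorem update_joinStacks_inl (S : ∀ k, List (Γ k)) (R : K₂ → List (Option Bool)) (k : K)
    (v : List (Γ k)) :
    Function.update (joinStacks S R) (.inl k) v = joinStacks (Function.update S k v) R := by
  funext j
  rcases j with j | j
  · by_cases h : j = k
    · subst h
      have h : joinStacks (Function.update S j v) R (.inl j) = v :=
        Function.update_self (β := fun k => List (Γ k)) j v S
      exact (Function.update_self _ _ _).trans h.symm
    · exact (Function.update_of_ne (by simpa using h) _ _).trans
        (Function.update_of_ne (β := fun k => List (Γ k)) h v S).symm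
  · exact Function.update_of_ne (by simp) _ _

theorem update_joinStacks_inr (S : ∀ k, List (Γ k)) (R : K₂ → List (Option Bool)) (k : K₂)
    (v : List (Option Bool)) :
    Function.update (joinStacks S R) (.inr k) v = joinStacks S (Function.update R k v) := by
  funext j
  rcases j with j | j
  · exact Function.update_of_ne (by simp) _ _
  · by_cases h : j = k
    · subst h
      have h : joinStacks S (Function.update R j v) (.inr j) = v :=
        Function.update_self (β := fun _ => List (Option Bool)) j v R
      exact (Function.update_self _ _ _).trans h.symm
    · exact (Function.update_of_ne (by simpa using h) _ _).trans
        (Function.update_of_ne (β := fun _ => List (Option Bool)) h v R).symm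

/-- The configuration after the execution of the program `q`. -/
def exec (q : LargeStmt K₂ Γ Λ Λ₂ σ σ₂) (v : σ) (w : σ₂) (S : ∀ k, List (Γ k))
    (R : K₂ → List (Option Bool)) : TM2.Cfg (Alphabet K₂ Γ) (Λ ⊕ Λ₂) (σ × σ₂) :=
  TM2.stepAux q (v, w) (joinStacks S R)

section Exec

variable (q q₁ q₂ : LargeStmt K₂ Γ Λ Λ₂ σ σ₂) (v : σ) (w : σ₂) (S : ∀ k, List (Γ k))
  (R : K₂ → List (Option Bool)) (k : K) (j : K₂)

@[simp] theorem exec_pushL (f : σ × σ₂ → Γ k) :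
    exec (pushL k f q) v w S R = exec q v w (Function.update S k (f (v, w) :: S k)) R :=
  congrArg (TM2.stepAux q (v, w)) (update_joinStacks_inl S R k (f (v, w) :: S k))

@[simp] theorem exec_peekL (f : σ × σ₂ → Option (Γ k) → σ × σ₂) :
    exec (peekL k f q) v w S R =
      exec q (f (v, w) (S k).head?).1 (f (v, w) (S k).head?).2 S R := rfl

@[simp] theorem exec_popL (f : σ × σ₂ → Option (Γ k) → σ × σ₂) :
    exec (popL k f q) v w S R = exec q (f (v, w) (S k).head?).1 (f (v, w) (S k).head?).2
      (Function.update S k (S k).tail) R :=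
  congrArg (TM2.stepAux q (f (v, w) (S k).head?)) (update_joinStacks_inl S R k (S k).tail)

@[simp] theorem exec_pushR (f : σ₂ → Option Bool) :
    exec (pushR j f q) v w S R = exec q v w S (Function.update R j (f w :: R j)) :=
  congrArg (TM2.stepAux q (v, w)) (update_joinStacks_inr S R j (f w :: R j))

@[simp] theorem exec_peekR (f : σ₂ → Option (Option Bool) → σ₂) :
    exec (peekR j f q) v w S R = exec q v (f w (R j).head?) S R := rfl

@[simp] theorem exec_popR (f : σ₂ → Option (Option Bool) → σ₂) :
    exec (popR j f q) v w S R =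
      exec q v (f w (R j).head?) S (Function.update R j (R j).tail) :=
  congrArg (TM2.stepAux q (v, f w (R j).head?)) (update_joinStacks_inr S R j (R j).tail)

@[simp] theorem exec_loadR (f : σ₂ → σ₂) :
    exec (loadR f q) v w S R = exec q v (f w) S R := rfl

@[simp] theorem exec_branchR (f : σ₂ → Bool) :
    exec (branchR f q₁ q₂) v w S R = if f w then exec q₁ v w S R else exec q₂ v w S R := by
  change cond (f w) _ _ = _
  cases f w <;> rfl

@[simp] theorem exec_gotoL (l : Λ) :
    exec (gotoL l) v w S R = largeCfg (Λ₂ := Λ₂) (some (.inl l)) v w S R := rfl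

@[simp] theorem exec_gotoR (l : Λ₂) :
    exec (gotoR l) v w S R = largeCfg (Λ := Λ) (some (.inr l)) v w S R := rfl

@[simp] theorem exec_halt :
    exec .halt v w S R = largeCfg (Λ := Λ) (Λ₂ := Λ₂) none v w S R := rfl

end Exec

/-- A configuration of the given machine as a configuration of the larger machine, with `e` in
place of the halted state. -/
def liftCfg (e : Option (Λ ⊕ Λ₂)) (w : σ₂) (R : K₂ → List (Option Bool)) (c : TM2.Cfg Γ Λ σ) :
    TM2.Cfg (Alphabet K₂ Γ) (Λ ⊕ Λ₂) (σ × σ₂) :=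
  largeCfg (c.l.elim e fun l => some (.inl l)) c.var w c.stk R

/-- A lifted program never touches the additional stacks and registers, so the two executions agree
statement by statement; they can differ only at `halt`, which is what `he` covers. -/
theorem exec_liftStmt {e : LargeStmt K₂ Γ Λ Λ₂ σ σ₂} {e' : Option (Λ ⊕ Λ₂)}
    (he : ∀ v w S R, exec e v w S R = largeCfg e' v w S R) (q : TM2.Stmt Γ Λ σ) (v : σ) (w : σ₂)
    (S : ∀ k, List (Γ k)) (R : K₂ → List (Option Bool)) :
    exec (liftStmt e q) v w S R = liftCfg e' w R (TM2.stepAux q v S) := by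
  induction q generalizing v S with
  | push k f q ih => simp only [liftStmt, exec_pushL]; exact ih _ _
  | peek k f q ih => exact ih _ _
  | pop k f q ih => simp only [liftStmt, exec_popL]; exact ih _ _
  | load f q ih => exact ih _ _
  | branch f q₁ q₂ ih₁ ih₂ =>
    simp only [liftStmt, TM2.stepAux]
    change cond (f v) _ _ = _
    cases f v
    · exact ih₂ _ _
    · exact ih₁ _ _
  | goto l => rfl
  | halt => exact he _ _ _ _

end Lift

/-! ### Initial and final configurations -/

section InitHalt

variable {K : Type} [DecidableEq K] {Γ : K → Type}

/-- The stacks that are empty except for the stack `k`, which holds `s`. -/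
def only (k : K) (s : List (Γ k)) : ∀ j, List (Γ j) :=
  Function.update (fun _ => []) k s

@[simp] theorem only_self (k : K) (s : List (Γ k)) : only k s k = s := by simp [only]

@[simp] theorem update_only (k : K) (s t : List (Γ k)) :
    Function.update (only k s) k t = only k t := by simp [only]

@[simp] theorem only_nil (k : K) : (only k [] : ∀ j, List (Γ j)) = fun _ => [] := by simp [only]

@[simp] theorem update_nil (k : K) (t : List (Γ k)) :
    Function.update (fun _ => []) k t = only k t := rfl

end InitHalt

theorem initList_eq (tm : FinTM2) (s : List (tm.Γ tm.k₀)) :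
    initList tm s = ⟨some tm.main, tm.initialState, only tm.k₀ s⟩ := by
  unfold initList
  congr 1
  funext k
  by_cases h : k = tm.k₀
  · subst h; simp
  · simp [h, only]

theorem haltList_eq (tm : FinTM2) (s : List (tm.Γ tm.k₁)) :
    haltList tm s = ⟨none, tm.initialState, only tm.k₁ s⟩ := by
  unfold haltList
  congr 1
  funext k
  by_cases h : k = tm.k₁
  · subst h; simp
  · simp [h, only]

theorem haltList_injective (tm : FinTM2) : Function.Injective (haltList tm) := by
  intro s t h
  rw [haltList_eq, haltList_eq] at h
  have h' : (only tm.k₁ s) tm.k₁ = (only tm.k₁ t) tm.k₁ := by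
    injection h with _ _ h
    rw [h]
  simpa using h'

/-! ### A deterministic machine that takes a majority vote over the runs listed in the advice -/

/-- The additional stacks of `voteTM`: the input, the word `x` (reversed) and a scratch copy of it,
the coins of the next run, and the surplus of votes. -/
inductive VoteStack
  | input | word | copy | coins | votes
  deriving DecidableEq

instance : Fintype VoteStack :=
  ⟨{.input, .word, .copy, .coins, .votes}, fun k => by cases k <;> simp⟩

/-- The additional labels of `voteTM`. -/
inductive VoteLabel
  | read | token | copy | vote | restore | clear (b : Bool)
  deriving DecidableEq, Fintype

/-- The additional registers of `voteTM`. -/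
abbrev VoteReg := Option (Option Bool) × Option (Option Bool) × Option (Option Bool)

/-- The contents of the additional stacks of `voteTM`. -/
def voteStacks (i x y c v : List (Option Bool)) : VoteStack → List (Option Bool)
  | .input => i
  | .word => x
  | .copy => y
  | .coins => c
  | .votes => v

section VoteStacks

variable (i x y c v s : List (Option Bool))

@[simp] theorem voteStacks_input : voteStacks i x y c v .input = i := rfl
@[simp] theorem voteStacks_word : voteStacks i x y c v .word = x := rfl
@[simp] theorem voteStacks_copy : voteStacks i x y c v .copy = y := rfl
@[simp] theorem voteStacks_coins : voteStacks i x y c v .coins = c := rfl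
@[simp] theorem voteStacks_votes : voteStacks i x y c v .votes = v := rfl

@[simp] theorem update_voteStacks_input :
    Function.update (voteStacks i x y c v) .input s = voteStacks s x y c v := by
  funext k; cases k <;> rfl
@[simp] theorem update_voteStacks_word :
    Function.update (voteStacks i x y c v) .word s = voteStacks i s y c v := by
  funext k; cases k <;> rfl
@[simp] theorem update_voteStacks_copy :
    Function.update (voteStacks i x y c v) .copy s = voteStacks i x s c v := by
  funext k; cases k <;> rfl
@[simp] theorem update_voteStacks_coins :
    Function.update (voteStacks i x y c v) .coins s = voteStacks i x y s v := by
  funext k; cases k <;> rfl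
@[simp] theorem update_voteStacks_votes :
    Function.update (voteStacks i x y c v) .votes s = voteStacks i x y c s := by
  funext k; cases k <;> rfl

theorem voteStacks_nil_input (s : List (Option Bool)) :
    voteStacks s [] [] [] [] = only VoteStack.input s := by
  funext k; cases k <;> rfl

end VoteStacks

theorem joinStacks_only_inr {K K₂ : Type} {Γ : K → Type} [DecidableEq K] [DecidableEq K₂] (k : K₂)
    (s : List (Option Bool)) :
    joinStacks (fun _ => [] : ∀ k, List (Γ k)) (only k s) = only (.inr k) s := by
  refine Eq.symm (Eq.trans ?_ (update_joinStacks_inr (fun _ => []) (fun _ => []) k s))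
  unfold only
  congr 1
  funext j
  rcases j with j | j <;> rfl

theorem joinStacks_only_inl {K K₂ : Type} {Γ : K → Type} [DecidableEq K] [DecidableEq K₂] (k : K)
    (s : List (Γ k)) :
    joinStacks (only k s) (fun _ => [] : K₂ → List (Option Bool)) = only (.inl k) s := by
  refine Eq.symm (Eq.trans ?_ (update_joinStacks_inl (fun _ => []) (fun _ => []) k s))
  unfold only
  congr 1
  funext j
  rcases j with j | j <;> rfl

section VoteTM

variable (M : ProbTM) (ia : M.Γ M.k₀ ≃ Option Bool) (oa : M.Γ M.k₁ ≃ Bool)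

/-- The program of `voteTM`. -/
def voteProgram : M.Λ ⊕ VoteLabel → LargeStmt VoteStack M.Γ M.Λ VoteLabel M.σ VoteReg
  -- An empty coin stack leaves `none` in the register, so the program for `false` is applied: coins
  -- that are not listed count as `false`. Halting of `M` becomes a jump to `vote`.
  | .inl l => popR .coins (fun w s => (s, w.2)) <|
      branchR (fun w => w.1 = some (some true))
        (loadR (fun _ => default) <| liftStmt (gotoR .vote) (M.mTrue l))
        (loadR (fun _ => default) <| liftStmt (gotoR .vote) (M.m l))
  | .inr .read => popR .input (fun w s => (s, w.2)) <|
      branchR (fun w => w.1.join.isSome)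
        (pushR .word (fun w => w.1.join) <| loadR (fun _ => default) <| gotoR .read)
        (loadR (fun _ => default) <| gotoR .token)
  -- The advice is read in tokens of three bits, two for an instruction and one for its argument.
  -- The instructions build the input of `M` from its end, on top of its input stack.
  | .inr .token => popR .input (fun w s => (s, w.2)) <| popR .input (fun w s => (w.1, s, w.2.2)) <|
      popR .input (fun w s => (w.1, w.2.1, s)) <|
      branchR (fun w => w.2.2.isSome)
        (branchR (fun w => w.1 = some (some true))
          (branchR (fun w => w.2.1 = some (some true))
            (pushL M.k₀ (fun _ => ia.symm none) <| loadR (fun _ => default) <| gotoR .copy)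
            (pushR .coins (fun w => w.2.2.join) <| loadR (fun _ => default) <| gotoR .token))
          (branchR (fun w => w.2.1 = some (some true))
            (pushL M.k₀ (fun _ => ia.symm none) <| pushL M.k₀ (fun v => ia.symm v.2.2.2.join) <|
              pushL M.k₀ (fun _ => ia.symm none) <| loadR (fun _ => default) <| gotoR .token)
            (peekL M.k₀ (fun v s => (v.1, s.map ia, v.2.2)) <|
              branchR (fun w => w.1.isSome)
                (pushL M.k₀ (fun v => ia.symm v.2.2.2.join) <|
                  loadR (fun _ => default) <| gotoR .token)
                (loadR (fun _ => default) <| gotoR .token))))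
        (peekR .votes (fun w s => (s, w.2)) <|
          branchR (fun w => w.1 = some (some true))
            (loadR (fun _ => default) <| gotoR (.clear true))
            (loadR (fun _ => default) <| gotoR (.clear false)))
  | .inr .copy => popR .word (fun w s => (s, w.2)) <|
      branchR (fun w => w.1.isSome)
        (pushR .copy (fun w => w.1.join) <| pushL M.k₀ (fun v => ia.symm v.2.1.join) <|
          loadR (fun _ => default) <| gotoR .copy)
        (loadR (fun _ => default) <| gotoL M.main)
  | .inr .vote => popL M.k₁ (fun v s => (v.1, s.map (fun b => some (oa b)), v.2.2)) <|
      peekR .votes (fun w s => (w.1, s, w.2.2)) <|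
      branchR (fun w => w.2.1 = none ∨ w.2.1 = w.1)
        (pushR .votes (fun w => w.1.join) <| loadR (fun _ => default) <| gotoR .restore)
        (popR .votes (fun w _ => w) <| loadR (fun _ => default) <| gotoR .restore)
  | .inr .restore => popR .copy (fun w s => (s, w.2)) <| popR .coins (fun w s => (w.1, s, w.2.2)) <|
      branchR (fun w => w.1.isSome)
        (pushR .word (fun w => w.1.join) <| loadR (fun _ => default) <| gotoR .restore)
        (branchR (fun w => w.2.1.isSome)
          (loadR (fun _ => default) <| gotoR .restore)
          (loadR (fun _ => default) <| gotoR .token))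
  -- An output configuration requires all stacks except the output stack to be empty.
  | .inr (.clear b) => popR .word (fun w s => (s, w.2)) <|
      popR .coins (fun w s => (w.1, s, w.2.2)) <|
      popR .votes (fun w s => (w.1, w.2.1, s)) <|
      branchR (fun w => w.1.isSome || w.2.1.isSome || w.2.2.isSome)
        (popL M.k₀ (fun v _ => v) <| loadR (fun _ => default) <| gotoR (.clear b))
        (popL M.k₀ (fun v s => (v.1, s.map ia, v.2.2)) <|
          branchR (fun w => w.1.isSome)
            (loadR (fun _ => default) <| gotoR (.clear b))
            (loadR (fun _ => default) <| pushL M.k₁ (fun _ => oa.symm b) .halt))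

/-- The deterministic machine that reads `x # a`, runs `M` on the input `x` with the lists of
examples and the coins that are described by `a`, and returns the majority of the outputs. -/
def voteTM : FinTM2 where
  K := M.K ⊕ VoteStack
  kDecidableEq := inferInstance
  kFin := letI := M.kFin; inferInstance
  k₀ := .inr .input
  k₁ := .inl M.k₁
  Γ := Alphabet VoteStack M.Γ
  Λ := M.Λ ⊕ VoteLabel
  main := .inr .read
  ΛFin := letI := M.ΛFin; inferInstance
  σ := M.σ × VoteReg
  initialState := (M.initialState, default)
  σFin := letI := M.σFin; inferInstance
  Γk₀Fin := inferInstanceAs (Fintype (Option Bool))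
  m := voteProgram M ia oa

/-- Add a vote to a surplus of votes. -/
def addVote (b : Bool) : List Bool → List Bool
  | [] => [b]
  | c :: v => if c = b then b :: c :: v else v

/-- Evaluate the runs that are listed in the advice, where `run es cs` is the result with the
examples `es` and the coins `cs`. -/
def collectVotes (run : List (List Bool × Bool) → List Bool → Bool) :
    List Bool → List (List Bool × Bool) → List Bool → List Bool → List Bool
  | true :: true :: _ :: a, es, cs, vs => collectVotes run a [] [] (addVote (run es cs) vs)
  | true :: false :: d :: a, es, cs, vs => collectVotes run a es (d :: cs) vs
  | false :: true :: d :: a, es, cs, vs => collectVotes run a (([], d) :: es) cs vs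
  | false :: false :: _ :: a, [], cs, vs => collectVotes run a [] cs vs
  | false :: false :: d :: a, (y, b) :: es, cs, vs => collectVotes run a ((d :: y, b) :: es) cs vs
  | _, _, _, vs => vs

/-- A step of `voteTM`. -/
def voteStep : TM2.Cfg (Alphabet VoteStack M.Γ) (M.Λ ⊕ VoteLabel) (M.σ × VoteReg) →
    Option (TM2.Cfg (Alphabet VoteStack M.Γ) (M.Λ ⊕ VoteLabel) (M.σ × VoteReg)) :=
  TM2.step (voteProgram M ia oa)

variable {M ia oa}

theorem voteStep_largeCfg (l : M.Λ ⊕ VoteLabel) (v : M.σ) (w : VoteReg) (S : ∀ k, List (M.Γ k))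
    (R : VoteStack → List (Option Bool)) :
    voteStep M ia oa (largeCfg (some l) v w S R) = some (exec (voteProgram M ia oa l) v w S R) :=
  rfl

/-! ### Loops of the voting machine -/

section Loops

variable {v : M.σ} {S : ∀ k, List (M.Γ k)}

theorem voteTM_read (x : List Bool) (a w : List (Option Bool)) :
    Within (voteStep M ia oa) (x.length + 1)
      (largeCfg (some (.inr .read)) v default S (voteStacks (x.map some ++ none :: a) w [] [] []))
      (largeCfg (some (.inr .token)) v default S
        (voteStacks a (x.reverse.map some ++ w) [] [] [])) := by
  induction x generalizing w with
  | nil =>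
    refine Within.head ?_ .refl
    rw [voteStep_largeCfg]
    simp [voteProgram]
  | cons b x ih =>
    refine Within.head (b := largeCfg (some (.inr .read)) v default S
      (voteStacks (x.map some ++ none :: a) (some b :: w) [] [] [])) ?_ ?_
    · rw [voteStep_largeCfg]
      simp [voteProgram]
    · simpa using ih (some b :: w)

theorem voteTM_copy (x : List Bool) (a y c vs : List (Option Bool)) (l : List (M.Γ M.k₀)) :
    Within (voteStep M ia oa) (x.length + 1)
      (largeCfg (some (.inr .copy)) v default (only M.k₀ l)
        (voteStacks a (x.map some) y c vs))
      (largeCfg (some (.inl M.main)) v default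
        (only M.k₀ ((x.reverse.map fun b => ia.symm (some b)) ++ l))
        (voteStacks a [] (x.reverse.map some ++ y) c vs)) := by
  induction x generalizing y l with
  | nil =>
    refine Within.head ?_ .refl
    rw [voteStep_largeCfg]
    simp [voteProgram]
  | cons b x ih =>
    refine Within.head (b := largeCfg (some (.inr .copy)) v default
      (only M.k₀ (ia.symm (some b) :: l))
      (voteStacks a (x.map some) (some b :: y) c vs)) ?_ ?_
    · rw [voteStep_largeCfg]
      simp [voteProgram]
    · simpa using ih (some b :: y) (ia.symm (some b) :: l)

theorem voteTM_restore (x : List Bool) (a w c vs : List (Option Bool)) {n : ℕ}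
    (hx : x.length ≤ n) (hc : c.length ≤ n) :
    Within (voteStep M ia oa) (n + 1)
      (largeCfg (some (.inr .restore)) v default S (voteStacks a w (x.map some) c vs))
      (largeCfg (some (.inr .token)) v default S
        (voteStacks a (x.reverse.map some ++ w) [] [] vs)) := by
  induction n generalizing x w c with
  | zero =>
    obtain rfl : x = [] := by simpa using hx
    obtain rfl : c = [] := by simpa using hc
    refine Within.head ?_ .refl
    rw [voteStep_largeCfg]
    simp [voteProgram]
  | succ n ih =>
    cases x with
    | nil =>
      cases c with
      | nil =>
        refine Within.head ?_ .refl
        rw [voteStep_largeCfg]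
        simp [voteProgram]
      | cons d c =>
        refine Within.head ?_ (ih [] w c (by simp) (by simpa using hc))
        rw [voteStep_largeCfg]
        simp [voteProgram]
    | cons b x =>
      have := ih x (some b :: w) c.tail (by simpa using hx) (by simp; omega)
      refine Within.head ?_ (by simpa using this)
      rw [voteStep_largeCfg]
      simp [voteProgram]

/-- Four stacks are emptied in a single loop. The induction runs over the common bound `n`, since
the stacks may run out at different times. -/
theorem voteTM_clear (b : Bool) (x c vs : List (Option Bool)) (l : List (M.Γ M.k₀)) {n : ℕ}
    (hx : x.length ≤ n) (hc : c.length ≤ n) (hv : vs.length ≤ n) (hl : l.length ≤ n) :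
    Within (voteStep M ia oa) (n + 1)
      (largeCfg (some (.inr (.clear b))) v default (only M.k₀ l) (voteStacks [] x [] c vs))
      (largeCfg none v default (only M.k₁ [oa.symm b]) (voteStacks [] [] [] [] [])) := by
  induction n generalizing x c vs l with
  | zero =>
    obtain rfl : x = [] := by simpa using hx
    obtain rfl : c = [] := by simpa using hc
    obtain rfl : vs = [] := by simpa using hv
    obtain rfl : l = [] := by simpa using hl
    refine Within.head ?_ .refl
    rw [voteStep_largeCfg]
    simp [voteProgram]
  | succ n ih =>
    have := ih x.tail c.tail vs.tail l.tail (by simp; omega) (by simp; omega) (by simp; omega)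
      (by simp; omega)
    by_cases h : x = [] ∧ c = [] ∧ vs = [] ∧ l = []
    · obtain ⟨rfl, rfl, rfl, rfl⟩ := h
      refine Within.head ?_ .refl
      rw [voteStep_largeCfg]
      simp [voteProgram]
    · refine Within.head ?_ this
      rw [voteStep_largeCfg]
      cases x <;> cases c <;> cases vs <;> cases l <;> simp [voteProgram] at h ⊢

/-- Each simulated step pops one coin, so `e.drop t` is left after `t` steps; the default `false` of
`getD` matches the behaviour on an empty coin stack. -/
theorem voteTM_run {e : List Bool} {c c' : M.toFinTM2.Cfg} {t : ℕ} {i x y vs : List (Option Bool)}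
    (h : M.run (fun k => e.getD k false) c t = some c') :
    StepsIn (voteStep M ia oa) t
      (liftCfg (some (.inr .vote)) default (voteStacks i x y (e.map some) vs) c)
      (liftCfg (some (.inr .vote)) default (voteStacks i x y ((e.drop t).map some) vs) c') := by
  induction t generalizing c' with
  | zero =>
    cases h
    rfl
  | succ t ih =>
    obtain ⟨d, hd, hd'⟩ := Option.bind_eq_some_iff.1 h
    refine (ih hd).trans (StepsIn.single ?_)
    rcases d with ⟨_ | l, u, T⟩
    · cases hd'
    · cases hd'
      have hdrop : (e.drop t).head? = e[t]? := by simp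
      have htail : (e.drop t).tail = e.drop (t + 1) := by simp
      change voteStep M ia oa (largeCfg (some (.inl l)) _ _ _ _) = _
      rw [voteStep_largeCfg]
      simp only [voteProgram, exec_popR, exec_branchR, exec_loadR, voteStacks_coins,
        update_voteStacks_coins, ← List.map_tail, htail, List.head?_map, hdrop]
      have he : ∀ v w S R, exec (gotoR .vote : LargeStmt VoteStack M.Γ M.Λ VoteLabel M.σ VoteReg)
          v w S R = largeCfg (some (.inr .vote)) v w S R := fun v w S R => rfl
      rw [exec_liftStmt he, exec_liftStmt he]
      cases hb : e[t]? with
      | none => simp [List.getD, hb]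
      | some b => cases b <;> simp [List.getD, hb]

end Loops

end VoteTM

/-! ### Output and running time of the voting machine -/

section Main

variable {M : ProbTM} {ia : M.Γ M.k₀ ≃ Option Bool} {oa : M.Γ M.k₁ ≃ Bool}
  {f : List Bool × List (List Bool × Bool) → (ℕ → Bool) → Bool} {time : Polynomial ℕ}

theorem length_addVote_le (b : Bool) (vs : List Bool) : (addVote b vs).length ≤ vs.length + 1 := by
  cases vs with
  | nil => simp [addVote]
  | cons c vs =>
    simp only [addVote]
    split_ifs
    · simp
    · simp only [List.length_cons]; omega

theorem voteTM_vote {v : M.σ} (b : Bool) (i x y c : List (Option Bool)) (vs : List Bool) :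
    Within (voteStep M ia oa) 1
      (largeCfg (some (.inr .vote)) v default (only M.k₁ [oa.symm b])
        (voteStacks i x y c (vs.map some)))
      (largeCfg (some (.inr .restore)) v default (fun _ => [])
        (voteStacks i x y c ((addVote b vs).map some))) := by
  refine Within.head (n := 0) ?_ .refl
  rw [voteStep_largeCfg]
  cases vs with
  | nil => simp [voteProgram, addVote]
  | cons d vs => by_cases h : d = b <;> simp [voteProgram, addVote, h]

/-- One complete run: copy `x` in front of the examples, simulate `M`, count its vote, restore `x`.
A halting configuration of `M` has its initial local variables and only the output on its stacks, so
once the vote is popped `M` is ready for the next run. -/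
theorem voteTM_segment
    (hM : ∀ a r, M.OutputsInTime r ((encodeWithExamples a).map ia.symm)
      ((Computability.encodeBool (f a r)).map oa.symm) (time.eval (encodeWithExamples a).length))
    (x : List Bool) (es : List (List Bool × Bool)) (cs vs : List Bool) (i : List (Option Bool))
    {n : ℕ} (hx : x.length ≤ n) (hcs : cs.length ≤ n) :
    Within (voteStep M ia oa) ((x.length + 1) + time.eval (encodeWithExamples (x, es)).length + 1
        + (n + 1))
      (largeCfg (some (.inr .copy)) M.initialState default
        (only M.k₀ ((none :: es.flatMap encodeExample).map ia.symm))
        (voteStacks i (x.reverse.map some) [] (cs.map some) (vs.map some)))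
      (largeCfg (some (.inr .token)) M.initialState default (fun _ => [])
        (voteStacks i (x.reverse.map some) [] []
          ((addVote (f (x, es) fun k => cs.getD k false) vs).map some))) := by
  have h₁ := voteTM_copy (M := M) (ia := ia) (oa := oa) (v := M.initialState) x.reverse i []
    (cs.map some) (vs.map some) ((none :: es.flatMap encodeExample).map ia.symm)
  obtain ⟨t, ht, hr⟩ := hM (x, es) (fun k => cs.getD k false)
  have h₂ := voteTM_run (ia := ia) (oa := oa) (i := i) (x := []) (y := x.map some)
    (vs := vs.map some) hr
  rw [initList_eq, haltList_eq] at h₂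
  have h₃ := voteTM_vote (ia := ia) (oa := oa) (v := M.initialState)
    (f (x, es) fun k => cs.getD k false) i [] (x.map some) ((cs.drop t).map some) vs
  have h₄ := voteTM_restore (M := M) (ia := ia) (oa := oa) (v := M.initialState)
    (S := fun _ => []) x i [] ((cs.drop t).map some)
    ((addVote (f (x, es) fun k => cs.getD k false) vs).map some) hx
    (by simp only [List.length_map, List.length_drop]; omega)
  refine Within.trans (Within.trans (Within.trans (b := largeCfg (some (.inl M.main))
    M.initialState default (only M.k₀ ((encodeWithExamples (x, es)).map ia.symm))
    (voteStacks i [] (x.map some) (cs.map some) (vs.map some))) ?_ ⟨t, ht, h₂⟩) h₃) ?_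
  · simpa [encodeWithExamples, Function.comp_def] using h₁
  · simpa using h₄

theorem length_flatMap_encodeExample_cons_digit (d b : Bool) (y : List Bool)
    (es : List (List Bool × Bool)) :
    (List.flatMap encodeExample ((d :: y, b) :: es)).length =
      (List.flatMap encodeExample ((y, b) :: es)).length + 1 := by
  simp [encodeExample]

/-- `W` bounds the cost of one token. The invariant `hn` persists because a token consumes three
bits and adds at most three symbols to the stacks; it keeps every simulated input short enough for
`hW`. -/
theorem voteTM_token
    (hM : ∀ a r, M.OutputsInTime r ((encodeWithExamples a).map ia.symm)
      ((Computability.encodeBool (f a r)).map oa.symm) (time.eval (encodeWithExamples a).length))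
    (x : List Bool) {n : ℕ} (hx : x.length ≤ n) {W : ℕ}
    (hW : ∀ k ≤ n, x.length + time.eval (x.length + 1 + k) + n + 5 ≤ W)
    (a : List Bool) (es : List (List Bool × Bool)) (cs vs : List Bool)
    (hn : (es.flatMap encodeExample).length + cs.length + vs.length + a.length ≤ n) :
    Within (voteStep M ia oa) (W * (a.length + 1))
      (largeCfg (some (.inr .token)) M.initialState default
        (only M.k₀ ((es.flatMap encodeExample).map ia.symm))
        (voteStacks (a.map some) (x.reverse.map some) [] (cs.map some) (vs.map some)))
      (largeCfg none M.initialState default (only M.k₁ [oa.symm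
        ((collectVotes (fun es cs => f (x, es) fun k => cs.getD k false) a es cs vs).head?.getD
          false)])
        (voteStacks [] [] [] [] [])) := by
  have hW₀ := hW 0 n.zero_le
  -- Fewer than three remaining bits form no token, and the machine proceeds to its answer.
  have hend : ∀ (a : List Bool) (es : List (List Bool × Bool)) (cs vs : List Bool), a.length < 3 →
      (es.flatMap encodeExample).length + cs.length + vs.length + a.length ≤ n →
      Within (voteStep M ia oa) (W * (a.length + 1))
      (largeCfg (some (.inr .token)) M.initialState default
        (only M.k₀ ((es.flatMap encodeExample).map ia.symm))
        (voteStacks (a.map some) (x.reverse.map some) [] (cs.map some) (vs.map some)))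
      (largeCfg none M.initialState default (only M.k₁ [oa.symm (vs.head?.getD false)])
        (voteStacks [] [] [] [] [])) := by
    intro a es cs vs ha hn
    have hclear := voteTM_clear (ia := ia) (oa := oa) (v := M.initialState) (vs.head?.getD false)
      (x.reverse.map some) (cs.map some) (vs.map some) ((es.flatMap encodeExample).map ia.symm)
      (n := n) (by simpa) (by simp; omega) (by simp; omega) (by simp only [List.length_map]; omega)
    refine (Within.head ?_ hclear).mono ?_
    · rw [voteStep_largeCfg]
      rcases a with _ | ⟨b₁, _ | ⟨b₂, _ | ⟨b₃, a⟩⟩⟩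
      · rcases vs with _ | ⟨_ | _, vs⟩ <;> simp [voteProgram]
      · rcases vs with _ | ⟨_ | _, vs⟩ <;> simp [voteProgram]
      · rcases vs with _ | ⟨_ | _, vs⟩ <;> simp [voteProgram]
      · simp only [List.length_cons] at ha; omega
    · calc n + 1 + 1 ≤ W * 1 := by omega
        _ ≤ _ := Nat.mul_le_mul_left _ (by omega)
  have hcost : ∀ a : List Bool, W * (a.length + 1) + W ≤ W * (a.length + 1 + 1 + 1 + 1) := by
    intro a
    nlinarith
  induction a, es, cs, vs using collectVotes.induct
    (fun es cs => f (x, es) fun k => cs.getD k false) with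
  | case1 d a es cs vs ih =>
    simp only [collectVotes, List.length_cons] at ih hn ⊢
    have hlen := length_addVote_le (f (x, es) fun k => cs.getD k false) vs
    have hseg := voteTM_segment hM x es cs vs (a.map some) hx (by omega)
    have := Within.trans hseg (by simpa using ih (by
      simp only [List.flatMap_nil, List.length_nil]; omega))
    refine (Within.head ?_ this).mono ?_
    · rw [voteStep_largeCfg]
      simp [voteProgram]
    · have := hW _ (show (es.flatMap encodeExample).length ≤ n by omega)
      have hl : (encodeWithExamples (x, es)).length =
          x.length + 1 + (es.flatMap encodeExample).length := by
        simp only [encodeWithExamples, List.length_append, List.length_map, List.length_cons]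
        omega
      rw [hl]
      have := hcost a
      omega
  | case2 d a es cs vs ih =>
    simp only [collectVotes, List.length_cons] at ih hn ⊢
    refine (Within.head ?_ (ih (by omega))).mono (by have := hcost a; omega)
    rw [voteStep_largeCfg]
    simp [voteProgram]
  | case3 d a es cs vs ih =>
    simp only [collectVotes, List.length_cons] at ih hn ⊢
    refine (Within.head ?_ (ih ?_)).mono (by have := hcost a; omega)
    · rw [voteStep_largeCfg]
      simp [voteProgram, encodeExample]
    · simp only [List.flatMap_cons, List.length_append, encodeExample, List.length_cons,
        List.length_nil, List.map_nil]
      omega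
  | case4 d a cs vs ih =>
    simp only [collectVotes, List.length_cons] at ih hn ⊢
    refine (Within.head ?_ (ih (by omega))).mono (by have := hcost a; omega)
    rw [voteStep_largeCfg]
    simp [voteProgram]
  | case5 d a y b es cs vs ih =>
    simp only [collectVotes, List.length_cons] at ih hn ⊢
    have hl := length_flatMap_encodeExample_cons_digit d b y es
    refine (Within.head ?_ (ih (by omega))).mono (by have := hcost a; omega)
    rw [voteStep_largeCfg]
    rcases y with _ | ⟨c, y⟩ <;> simp [voteProgram, encodeExample]
  -- The five other patterns exhaust all lists with at least three bits, so the default case only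
  -- sees shorter ones.
  | case6 a es cs vs h₁ h₂ h₃ h₄ h₅ =>
    have ha : a.length < 3 := by
      by_contra h
      rcases a with _ | ⟨b₁, _ | ⟨b₂, _ | ⟨b₃, a⟩⟩⟩
      · simp at h
      · simp at h
      · simp at h
      · rcases b₁ with _ | _ <;> rcases b₂ with _ | _
        · rcases es with _ | ⟨⟨y, b⟩, es⟩
          · exact h₄ _ _ rfl rfl
          · exact h₅ _ _ _ _ _ rfl rfl
        · exact h₃ _ _ rfl
        · exact h₂ _ _ rfl
        · exact h₁ _ _ rfl
    have : collectVotes (fun es cs => f (x, es) fun k => cs.getD k false) a es cs vs = vs := by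
      rcases a with _ | ⟨b₁, _ | ⟨b₂, _ | ⟨b₃, a⟩⟩⟩
      · rfl
      · cases b₁ <;> rfl
      · cases b₁ <;> cases b₂ <;> rfl
      · simp only [List.length_cons] at ha; omega
    rw [this]
    exact hend a es cs vs ha hn

theorem polynomial_eval_mono (p : Polynomial ℕ) : Monotone fun n : ℕ => p.eval n := by
  intro m n h
  simp only [Polynomial.eval_eq_sum]
  exact Finset.sum_le_sum fun i _ => Nat.mul_le_mul_left _ (Nat.pow_le_pow_left h i)

/-- The majority of the outputs of the runs that are listed in the advice `a`. -/
def majorityOfRuns (f : List Bool × List (List Bool × Bool) → (ℕ → Bool) → Bool)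
    (z : List Bool × List Bool) : Bool :=
  (collectVotes (fun es cs => f (z.1, es) fun k => cs.getD k false) z.2 [] [] []).head?.getD false

/-- A bound for the running time of `voteTM`, where `time` is a bound for the running time of the
given machine. -/
noncomputable def voteTime (time : Polynomial ℕ) : Polynomial ℕ :=
  .X + (2 * .X + time.comp (2 * .X) + 5) * (.X + 1)

theorem majorityOfRuns_computable
    (hf : ProbComputableInPolyTime encodeWithExamples Computability.encodeBool f) :
    Nonempty (TM2ComputableInPolyTime encodePair Computability.encodeBool (majorityOfRuns f)) := by
  obtain ⟨M, ia, oa, time, hM⟩ := hf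
  have key : ∀ z : List Bool × List Bool, Nonempty (TM2OutputsInTime (voteTM M ia oa)
      ((encodePair z).map (Equiv.refl (Option Bool)).invFun)
      (some ((Computability.encodeBool (majorityOfRuns f z)).map oa.invFun))
      ((voteTime time).eval (encodePair z).length)) := by
    rintro ⟨x, a⟩
    refine within_iff_nonempty_evalsToInTime.1 ?_
    have hl : (encodePair (x, a)).length = x.length + 1 + a.length := by
      simp [encodePair]; omega
    have h₁ := voteTM_read (ia := ia) (oa := oa) (v := M.initialState) (S := fun _ => []) x
      (a.map some) []
    -- All stacks start empty, so the invariant holds with `n = x.length + a.length`. Inputs of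
    -- simulated runs then have length at most twice that of `x # a`, hence the argument `2 * .X` in
    -- `voteTime`.
    have h₂ := voteTM_token (ia := ia) (oa := oa) hM x (n := x.length + a.length) (by omega)
      (W := 2 * (x.length + 1 + a.length) +
        time.eval (2 * (x.length + 1 + a.length)) + 5) ?_ a [] [] []
      (by simp)
    · have h := Within.trans (by simpa using h₁) (by simpa using h₂)
      rw [initList_eq, haltList_eq]
      have e₁ : (⟨some (voteTM M ia oa).main, (voteTM M ia oa).initialState,
          only (voteTM M ia oa).k₀ ((encodePair (x, a)).map (Equiv.refl (Option Bool)).invFun)⟩ :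
          (voteTM M ia oa).Cfg) = largeCfg (some (.inr .read)) M.initialState default
            (fun _ => []) (voteStacks (x.map some ++ none :: a.map some) [] [] [] []) := by
        rw [voteStacks_nil_input]
        unfold largeCfg
        rw [joinStacks_only_inr]
        exact congrArg (fun l => (⟨some (.inr .read), (M.initialState, default),
          only (Γ := Alphabet VoteStack M.Γ) (.inr .input) l⟩ : (voteTM M ia oa).Cfg))
          (List.map_id (x.map some ++ none :: a.map some))
      have e₂ : (⟨none, (voteTM M ia oa).initialState, only (voteTM M ia oa).k₁
          ((Computability.encodeBool (majorityOfRuns f (x, a))).map oa.invFun)⟩ :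
          (voteTM M ia oa).Cfg) = largeCfg none M.initialState default
            (only M.k₁ [oa.symm (majorityOfRuns f (x, a))]) (voteStacks [] [] [] [] []) := by
        rw [voteStacks_nil_input, only_nil]
        unfold largeCfg
        rw [joinStacks_only_inl]
        rfl
      rw [e₁, e₂]
      refine Within.mono h ?_
      rw [hl]
      simp only [voteTime, Polynomial.eval_add, Polynomial.eval_mul, Polynomial.eval_X,
        Polynomial.eval_one, Polynomial.eval_ofNat, Polynomial.eval_comp]
      exact Nat.add_le_add (by omega) (Nat.mul_le_mul_left _ (by omega))
    · intro k hk
      have := polynomial_eval_mono time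
        (show x.length + 1 + k ≤ 2 * (x.length + 1 + a.length) by omega)
      simp only at this
      omega
  exact ⟨⟨⟨voteTM M ia oa, Equiv.refl (Option Bool), oa⟩, voteTime time, fun z => (key z).some⟩⟩

end Main

/-! ### Majority votes -/

/-- Opposite votes cancel, so the stack always consists of equal votes, and its signed size is the
difference between the votes for `true` and for `false`. -/
theorem head?_foldl_addVote_aux (outs : List Bool) (m : ℕ) (c : Bool) :
    ∃ (m' : ℕ) (c' : Bool), outs.foldl (fun vs b => addVote b vs) (List.replicate m c) =
        List.replicate m' c' ∧
      ((List.replicate m' c').count true : ℤ) - (List.replicate m' c').count false =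
        (List.replicate m c).count true - (List.replicate m c).count false +
          (outs.count true - outs.count false) := by
  induction outs generalizing m c with
  | nil => exact ⟨m, c, by simp, by simp⟩
  | cons b outs ih =>
    rw [List.foldl_cons]
    cases m with
    | zero =>
      obtain ⟨m', c', h, h'⟩ := ih 1 b
      refine ⟨m', c', h, h'.trans ?_⟩
      cases b <;> simp <;> ring
    | succ m =>
      by_cases hc : c = b
      · subst hc
        obtain ⟨m', c', h, h'⟩ := ih (m + 2) c
        refine ⟨m', c', ?_, h'.trans ?_⟩
        · rw [← h]
          simp [addVote, List.replicate_succ]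
        · cases c <;> simp [List.count_replicate] <;> ring
      · obtain ⟨m', c', h, h'⟩ := ih m c
        refine ⟨m', c', ?_, h'.trans ?_⟩
        · rw [← h]
          simp [addVote, List.replicate_succ, hc]
        · cases c <;> cases b <;> simp [List.count_replicate] at hc ⊢ <;> ring

/-- If most of the votes are for `b`, then so is the surplus. -/
theorem head?_foldl_addVote {outs : List Bool} {b : Bool} (h : outs.count (!b) < outs.count b) :
    (outs.foldl (fun vs b => addVote b vs) []).head?.getD false = b := by
  obtain ⟨m, c, h₁, h₂⟩ := head?_foldl_addVote_aux outs 0 false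
  simp only [List.replicate_zero] at h₁
  rw [h₁]
  cases m with
  | zero =>
    simp only [List.replicate_zero, List.count_nil] at h₂
    cases b <;> simp only [Bool.not_false, Bool.not_true] at h <;> omega
  | succ m =>
    cases b <;> cases c <;> simp [List.count_replicate] at h₂ h <;> first | rfl | omega

/-! ### Writing runs into the advice -/

/-- The advice for the word `y` of an example. -/
def digitBits : List Bool → List Bool
  | [] => []
  | d :: y => digitBits y ++ [false, false, d]

/-- The advice for a list of examples. -/
def exampleBits : List (List Bool × Bool) → List Bool
  | [] => []
  | e :: es => exampleBits es ++ (false :: true :: e.2 :: digitBits e.1)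

/-- The advice for a list of coins. -/
def coinBits : List Bool → List Bool
  | [] => []
  | d :: cs => coinBits cs ++ [true, false, d]

/-- The advice for a run. -/
def runBits (s : List (List Bool × Bool) × List Bool) : List Bool :=
  exampleBits s.1 ++ (coinBits s.2 ++ [true, true, true])

section Bits

variable (run : List (List Bool × Bool) → List Bool → Bool)

/-- Every token prepends one letter to the front example, which is why the advice spells words (and
likewise lists of examples and coins) from last to first. -/
theorem collectVotes_digitBits (y a y' : List Bool) (b : Bool) (es : List (List Bool × Bool))
    (cs vs : List Bool) :
    collectVotes run (digitBits y ++ a) ((y', b) :: es) cs vs =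
      collectVotes run a ((y ++ y', b) :: es) cs vs := by
  induction y generalizing a with
  | nil => rfl
  | cons d y ih => simp [digitBits, ih, collectVotes]

theorem collectVotes_exampleBits (es : List (List Bool × Bool)) (a cs vs : List Bool) :
    collectVotes run (exampleBits es ++ a) [] cs vs = collectVotes run a es cs vs := by
  induction es generalizing a with
  | nil => rfl
  | cons e es ih => simp [exampleBits, ih, collectVotes, collectVotes_digitBits]

theorem collectVotes_coinBits (cs a vs : List Bool) (es : List (List Bool × Bool)) :
    collectVotes run (coinBits cs ++ a) es [] vs = collectVotes run a es cs vs := by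
  induction cs generalizing a with
  | nil => rfl
  | cons d cs ih => simp [coinBits, ih, collectVotes]

theorem collectVotes_runBits (s : List (List Bool × Bool) × List Bool) (a vs : List Bool) :
    collectVotes run (runBits s ++ a) [] [] vs =
      collectVotes run a [] [] (addVote (run s.1 s.2) vs) := by
  simp [runBits, collectVotes_exampleBits, collectVotes_coinBits, collectVotes]

theorem collectVotes_flatMap_runBits (l : List (List (List Bool × Bool) × List Bool))
    (vs : List Bool) :
    collectVotes run (l.flatMap runBits) [] [] vs =
      (l.map fun s => run s.1 s.2).foldl (fun vs b => addVote b vs) vs := by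
  induction l generalizing vs with
  | nil => rfl
  | cons s l ih => simp [collectVotes_runBits, ih]

end Bits

theorem length_digitBits (y : List Bool) : (digitBits y).length = 3 * y.length := by
  induction y with
  | nil => rfl
  | cons d y ih => simp [digitBits, ih]; ring

theorem length_exampleBits {es : List (List Bool × Bool)} {n : ℕ} (h : ∀ e ∈ es, e.1.length = n) :
    (exampleBits es).length = es.length * (3 * n + 3) := by
  induction es with
  | nil => simp [exampleBits]
  | cons e es ih =>
    simp only [List.mem_cons, forall_eq_or_imp] at h
    simp [exampleBits, ih h.2, length_digitBits, h.1]
    ring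

theorem length_coinBits (cs : List Bool) : (coinBits cs).length = 3 * cs.length := by
  induction cs with
  | nil => rfl
  | cons d y ih => simp [coinBits, ih]; ring

theorem length_runBits {s : List (List Bool × Bool) × List Bool} {n : ℕ}
    (h : ∀ e ∈ s.1, e.1.length = n) :
    (runBits s).length = s.1.length * (3 * n + 3) + 3 * s.2.length + 3 := by
  simp [runBits, length_exampleBits h, length_coinBits]
  ring

theorem length_flatMap_encodeExample {es : List (List Bool × Bool)} {n : ℕ}
    (h : ∀ e ∈ es, e.1.length = n) : (es.flatMap encodeExample).length = es.length * (n + 3) := by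
  induction es with
  | nil => simp
  | cons e es ih =>
    simp only [List.mem_cons, forall_eq_or_imp] at h
    rw [List.flatMap_cons, List.length_append, ih h.2]
    simp [encodeExample, h.1]
    ring

/-! ### A probabilistic machine reads only finitely many coins -/

theorem ProbTM.run_congr (M : ProbTM) {r r' : ℕ → Bool} {c : M.toFinTM2.Cfg} {t : ℕ}
    (h : ∀ i < t, r i = r' i) : M.run r c t = M.run r' c t := by
  induction t with
  | zero => rfl
  | succ t ih =>
    simp only [ProbTM.run]
    rw [ih fun i hi => h i (by omega), h t (by omega)]

theorem ProbTM.run_eq_none_of_halted (M : ProbTM) {r : ℕ → Bool} {c d : M.toFinTM2.Cfg} {s t : ℕ}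
    (h : M.run r c s = some d) (hd : d.l = none) (hst : s < t) : M.run r c t = none := by
  induction t with
  | zero => omega
  | succ t ih =>
    simp only [ProbTM.run]
    rcases Nat.lt_succ_iff_lt_or_eq.1 hst with hst | rfl
    · rw [ih hst]; rfl
    · rw [h]
      rcases d with ⟨_ | l, u, T⟩
      · rfl
      · cases hd

/-- After halting, `run` is `none`, so for fixed coins at most one time shows a halted
configuration. -/
theorem ProbTM.OutputsInTime.unique {M : ProbTM} {r : ℕ → Bool} {l : List (M.Γ M.k₀)}
    {l₁ l₂ : List (M.Γ M.k₁)} {T₁ T₂ : ℕ} (h₁ : M.OutputsInTime r l l₁ T₁)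
    (h₂ : M.OutputsInTime r l l₂ T₂) : l₁ = l₂ := by
  obtain ⟨t₁, -, h₁⟩ := h₁
  obtain ⟨t₂, -, h₂⟩ := h₂
  have hl : ∀ l, (haltList M.toFinTM2 l).l = none := fun l => rfl
  rcases lt_trichotomy t₁ t₂ with h | rfl | h
  · rw [M.run_eq_none_of_halted h₁ (hl _) h] at h₂
    cases h₂
  · rw [h₁] at h₂
    exact haltList_injective _ (Option.some.inj h₂)
  · rw [M.run_eq_none_of_halted h₂ (hl _) h] at h₁
    cases h₁

/-- A halting run uses only the coins tossed before its end, so it is also a run for any coins that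
agree with these; uniqueness of the output does the rest. -/
theorem ProbComputableInPolyTime.exists_polynomial_congr {α αΓ : Type} {ea : α → List αΓ}
    {f : α → (ℕ → Bool) → Bool}
    (hf : ProbComputableInPolyTime ea Computability.encodeBool f) :
    ∃ time : Polynomial ℕ, ∀ a r r', (∀ i < time.eval (ea a).length, r i = r' i) →
      f a r = f a r' := by
  obtain ⟨M, ia, oa, time, hM⟩ := hf
  refine ⟨time, fun a r r' h => ?_⟩
  have h₁ := hM a r
  obtain ⟨t, ht, hr⟩ := hM a r'
  have h₂ : M.OutputsInTime r ((ea a).map ia.symm)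
      ((Computability.encodeBool (f a r')).map oa.symm) (time.eval (ea a).length) :=
    ⟨t, ht, (M.run_congr fun i hi => h i (by omega)).trans hr⟩
  have := h₁.unique h₂
  simpa [Computability.encodeBool] using this

/-! ### Choosing the runs -/

/-- If each of finitely many events has probability at most `1/3`, then some outcome lies only in
events whose total weight is at most a third of the total. -/
theorem exists_weight_le {Ω ι : Type*} [MeasurableSpace Ω] [Fintype ι] (μ : Measure Ω)
    [IsProbabilityMeasure μ] {A : ι → Set Ω} (hA : ∀ i, MeasurableSet (A i))
    (hμ : ∀ i, μ.real (A i) ≤ 1 / 3) (w : ι → ℕ) :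
    ∃ ω, 3 * ∑ i, (A i).indicator (fun _ => w i) ω ≤ ∑ i, w i := by
  have hint : ∀ i, Integrable ((A i).indicator fun _ => (w i : ℝ)) μ := fun i =>
    (integrable_const _).indicator (hA i)
  -- Some outcome is no worse than the expected weight of the events containing it.
  obtain ⟨ω, hω⟩ := exists_le_integral (μ := μ)
    (f := fun ω => ∑ i, (A i).indicator (fun _ => (w i : ℝ)) ω)
    (integrable_finsetSum _ fun i _ => hint i)
  refine ⟨ω, ?_⟩
  rw [integral_finsetSum _ fun i _ => hint i] at hω
  have h : ∑ i, ∫ ω, (A i).indicator (fun _ => (w i : ℝ)) ω ∂μ ≤ ∑ i, (w i : ℝ) / 3 := by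
    refine Finset.sum_le_sum fun i _ => ?_
    rw [integral_indicator_const _ (hA i), smul_eq_mul]
    nlinarith [hμ i, (w i).cast_nonneg (α := ℝ)]
  have h' : ((3 * ∑ i, (A i).indicator (fun _ => w i) ω : ℕ) : ℝ) ≤ ((∑ i, w i : ℕ) : ℝ) := by
    push_cast
    have e : ∀ i, (((A i).indicator (fun _ => w i) ω : ℕ) : ℝ) =
        (A i).indicator (fun _ => (w i : ℝ)) ω := by
      intro i
      by_cases hi : ω ∈ A i <;> simp [hi]
    simp only [e]
    rw [← Finset.sum_div] at h
    linarith
  exact_mod_cast h'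

/-- If each of `card ι` events has probability at most `1/3`, then there is a list of `k` outcomes
such that the numbers of them in the events are small. -/
theorem exists_list_sum_le {Ω ι : Type*} [MeasurableSpace Ω] [Fintype ι] (μ : Measure Ω)
    [IsProbabilityMeasure μ] {A : ι → Set Ω} (hA : ∀ i, MeasurableSet (A i))
    (hμ : ∀ i, μ.real (A i) ≤ 1 / 3) [∀ i, DecidablePred (· ∈ A i)] (k : ℕ) :
    ∃ l : List Ω, l.length = k ∧
      3 ^ k * ∑ i, 2 ^ (l.countP fun ω => ω ∈ A i) ≤ Fintype.card ι * 4 ^ k := by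
  induction k with
  | zero => exact ⟨[], rfl, by simp⟩
  | succ k ih =>
    obtain ⟨l, hl, h⟩ := ih
    obtain ⟨ω, hω⟩ := exists_weight_le μ hA hμ fun i => 2 ^ (l.countP fun ω => ω ∈ A i)
    refine ⟨ω :: l, by simp [hl], ?_⟩
    -- Adding `ω` doubles the weights of exactly the events that contain it. These make up at most a
    -- third of the total, so the total grows by a factor of at most 4/3.
    have e : ∀ i, 2 ^ ((ω :: l).countP fun ω => ω ∈ A i) = 2 ^ (l.countP fun ω => ω ∈ A i) +
        (A i).indicator (fun _ => 2 ^ (l.countP fun ω => ω ∈ A i)) ω := by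
      intro i
      by_cases hi : ω ∈ A i
      · simp [hi, pow_succ]; ring
      · simp [hi]
    simp only [e, Finset.sum_add_distrib]
    calc _ = 3 ^ k * (3 * ∑ i, 2 ^ (l.countP fun ω => ω ∈ A i) +
          3 * ∑ i, (A i).indicator (fun _ => 2 ^ (l.countP fun ω => ω ∈ A i)) ω) := by ring
      _ ≤ 3 ^ k * (3 * ∑ i, 2 ^ (l.countP fun ω => ω ∈ A i) +
          ∑ i, 2 ^ (l.countP fun ω => ω ∈ A i)) := by gcongr
      _ = 4 * (3 ^ k * ∑ i, 2 ^ (l.countP fun ω => ω ∈ A i)) := by ring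
      _ ≤ 4 * (Fintype.card ι * 4 ^ k) := by gcongr
      _ = _ := by ring

/-- An event containing half of the outcomes would contribute `2 ^ (6 * (n + 1))` to a sum that is
at most `2 ^ n * (4/3) ^ (12 * (n + 1))`. The factor 12 makes this impossible, because `2 ^ 19 ≤ 3 ^
12`. -/
theorem exists_list_majority {Ω : Type*} [MeasurableSpace Ω] (μ : Measure Ω)
    [IsProbabilityMeasure μ] {n : ℕ} {A : (Fin n → Bool) → Set Ω} (hA : ∀ i, MeasurableSet (A i))
    (hμ : ∀ i, μ.real (A i) ≤ 1 / 3) [∀ i, DecidablePred (· ∈ A i)] :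
    ∃ l : List Ω, l.length = 12 * (n + 1) ∧
      ∀ i, (l.countP fun ω => ω ∈ A i) < 6 * (n + 1) := by
  obtain ⟨l, hl, h⟩ := exists_list_sum_le μ hA hμ (12 * (n + 1))
  refine ⟨l, hl, fun i => ?_⟩
  by_contra! hi
  have h₁ : 2 ^ (6 * (n + 1)) ≤ ∑ i, 2 ^ (l.countP fun ω => ω ∈ A i) :=
    (Nat.pow_le_pow_right two_pos hi).trans (Finset.single_le_sum
      (f := fun i => 2 ^ (l.countP fun ω => ω ∈ A i)) (fun _ _ => Nat.zero_le _)
      (Finset.mem_univ i))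
  have h₂ : 3 ^ (12 * (n + 1)) * 2 ^ (6 * (n + 1)) ≤ 2 ^ n * 4 ^ (12 * (n + 1)) := by
    refine (Nat.mul_le_mul_left _ h₁).trans (h.trans ?_)
    simp
  -- In exponents of two: `n + 24 * (n + 1) < 25 * (n + 1)`.
  have h₃ : 2 ^ n * 4 ^ (12 * (n + 1)) < 2 ^ (19 * (n + 1)) * 2 ^ (6 * (n + 1)) := by
    rw [show (4 : ℕ) = 2 ^ 2 from rfl, ← pow_mul, ← pow_add, ← pow_add]
    exact Nat.pow_lt_pow_right (by norm_num) (by omega)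
  have h₄ : 2 ^ (19 * (n + 1)) ≤ 3 ^ (12 * (n + 1)) := by
    rw [pow_mul, pow_mul]
    exact Nat.pow_le_pow_left (by norm_num) _
  have := Nat.mul_le_mul_right (2 ^ (6 * (n + 1))) h₄
  omega

instance {n : ℕ} (D : PMF (Fin n → Bool)) (m : ℕ) : IsProbabilityMeasure (sampleLaw D m) := by
  unfold sampleLaw; infer_instance

instance : IsProbabilityMeasure coinLaw := by
  unfold coinLaw; infer_instance

/-- The set is the preimage of a subset of a finite space under restriction to the first `T` coins.
-/
theorem measurableSet_of_finite_coins {n m T : ℕ} {A : Set ((Fin m → Fin n → Bool) × (ℕ → Bool))}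
    (hA : ∀ s r r', (∀ i < T, r i = r' i) → (s, r) ∈ A → (s, r') ∈ A) : MeasurableSet A := by
  let g : (Fin m → Fin n → Bool) × (ℕ → Bool) → (Fin m → Fin n → Bool) × (Fin T → Bool) :=
    fun ω => (ω.1, fun i => ω.2 i)
  have hg : Measurable g := by fun_prop
  have : A = g ⁻¹' (g '' A) := by
    refine (Set.subset_preimage_image g A).antisymm ?_
    rintro ⟨s, r⟩ ⟨⟨s', r'⟩, h, he⟩
    simp only [g, Prod.mk.injEq] at he
    obtain ⟨rfl, he⟩ := he
    exact hA _ _ _ (fun i hi => congrFun he ⟨i, hi⟩) h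
  rw [this]
  exact hg (Set.toFinite _).measurableSet

theorem length_trainingSet (L : Language Bool) {n m : ℕ} (s : Fin m → Fin n → Bool) :
    (trainingSet L s).length = m := by
  simp [trainingSet]

theorem length_of_mem_trainingSet (L : Language Bool) {n m : ℕ} {s : Fin m → Fin n → Bool}
    {e : List Bool × Bool} (he : e ∈ trainingSet L s) : e.1.length = n := by
  simp only [trainingSet, List.mem_ofFn] at he
  obtain ⟨i, rfl⟩ := he
  simp

theorem bppSamp_subset_pPoly : BPPSamp ⊆ PPoly := by
  rintro L ⟨f, hf, D, p, hL⟩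
  obtain ⟨time, htime⟩ := hf.exists_polynomial_congr
  refine ⟨majorityOfRuns f, majorityOfRuns_computable hf, ?_⟩
  -- The number of coins that matter: all inputs made of a word of length `n` and a training set for
  -- `n` have the same encoded length. `q` is the length of `12 * (n + 1)` listed runs.
  let T : Polynomial ℕ := time.comp (.X + 1 + p * (.X + 3))
  let q : Polynomial ℕ := 12 * (.X + 1) * (p * (3 * .X + 3) + 3 * T + 3)
  suffices H : ∀ n, ∃ a : List Bool, a.length ≤ q.eval n ∧
      ∀ x : List Bool, x.length = n → majorityOfRuns f (x, a) = indicator L x by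
    choose a ha ha' using H
    exact ⟨a, q, ha, fun x => ha' _ x rfl⟩
  intro n
  classical
  have hlen : ∀ (x : Fin n → Bool) (s : Fin (p.eval n) → Fin n → Bool),
      time.eval (encodeWithExamples (List.ofFn x, trainingSet L s)).length = T.eval n := by
    intro x s
    have : (encodeWithExamples (List.ofFn x, trainingSet L s)).length =
        n + 1 + p.eval n * (n + 3) := by
      simp only [encodeWithExamples, List.length_append, List.length_map, List.length_cons,
        length_flatMap_encodeExample fun e he => length_of_mem_trainingSet L he,
        length_trainingSet, List.length_ofFn]
      ring
    rw [this]
    simp [T]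
  let A : (Fin n → Bool) → Set ((Fin (p.eval n) → Fin n → Bool) × (ℕ → Bool)) := fun x =>
    {ω | f (List.ofFn x, trainingSet L ω.1) ω.2 ≠ indicator L (List.ofFn x)}
  have hA : ∀ x, MeasurableSet (A x) := by
    refine fun x => measurableSet_of_finite_coins (T := T.eval n) fun s r r' h hs => ?_
    simp only [A, Set.mem_ofPred_eq] at hs ⊢
    rwa [htime _ r' r fun i hi => (h i (by rwa [hlen] at hi)).symm]
  have hμ : ∀ x, ((sampleLaw (D n) (p.eval n)).prod coinLaw).real (A x) ≤ 1 / 3 := by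
    intro x
    have h := hL (List.ofFn x)
    have h' : 2 / 3 ≤ ((sampleLaw (D n) (p.eval n)).prod coinLaw) (A x)ᶜ := by
      have e : (List.ofFn x).length = n := by simp
      -- The type of the samples depends on `(List.ofFn x).length`, so the bound is transported
      -- along an equation of lengths.
      have h₀ : ∀ (n' : ℕ), n' = n → 2 / 3 ≤ ((sampleLaw (D n') (p.eval n')).prod coinLaw)
          {ω | f (List.ofFn x, trainingSet L ω.1) ω.2 = indicator L (List.ofFn x)} →
          2 / 3 ≤ ((sampleLaw (D n) (p.eval n)).prod coinLaw) (A x)ᶜ := by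
        rintro n' rfl h
        convert h using 2
        ext ω
        simp [A]
      exact h₀ _ e h
    have h'' : 2 / 3 ≤ ((sampleLaw (D n) (p.eval n)).prod coinLaw).real (A x)ᶜ := by
      have := ENNReal.toReal_mono (measure_ne_top _ _) h'
      simpa [Measure.real] using this
    rw [probReal_compl_eq_one_sub (hA x)] at h''
    linarith
  obtain ⟨l, hl, hmaj⟩ := exists_list_majority _ hA hμ
  -- The labels are part of the advice, so the deterministic machine never has to compute them.
  let seed : (Fin (p.eval n) → Fin n → Bool) × (ℕ → Bool) → List (List Bool × Bool) × List Bool :=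
    fun ω => (trainingSet L ω.1, List.ofFn fun i : Fin (T.eval n) => ω.2 i)
  refine ⟨(l.map seed).flatMap runBits, ?_, ?_⟩
  · have hb : ∀ s ∈ l.map seed, (runBits s).length =
        p.eval n * (3 * n + 3) + 3 * T.eval n + 3 := by
      intro s hs
      obtain ⟨ω, -, rfl⟩ := List.mem_map.1 hs
      rw [length_runBits (n := n) fun e he => length_of_mem_trainingSet L he]
      simp [seed, length_trainingSet]
    rw [List.length_flatMap, List.map_congr_left hb]
    simp [Function.comp_def, hl, q]
  · rintro x rfl
    obtain ⟨y, hy⟩ : ∃ y : Fin x.length → Bool, List.ofFn y = x := ⟨x.get, List.ofFn_get x⟩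
    have hrun : ∀ ω, (f (x, (seed ω).1) fun k => (seed ω).2.getD k false) =
        f (x, trainingSet L ω.1) ω.2 := by
      intro ω
      refine htime _ _ _ fun i hi => ?_
      rw [← hy, hlen] at hi
      simp [seed, List.getD, hi]
    unfold majorityOfRuns
    simp only
    rw [collectVotes_flatMap_runBits]
    refine head?_foldl_addVote ?_
    have := hmaj y
    have e : (List.map (fun s => f (x, s.1) fun k => s.2.getD k false) (l.map seed)) =
        l.map fun ω => f (x, trainingSet L ω.1) ω.2 := by
      rw [List.map_map]
      exact List.map_congr_left fun ω _ => hrun ω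
    rw [e]
    have h₁ : (l.map fun ω => f (x, trainingSet L ω.1) ω.2).count (!indicator L x) =
        l.countP fun ω => ω ∈ A y := by
      rw [List.count, List.countP_map]
      refine List.countP_congr fun ω _ => ?_
      simp only [A, hy, Function.comp_apply, Set.mem_ofPred_eq, beq_iff_eq, decide_eq_true_eq]
      exact Bool.eq_not
    have h₂ := List.length_eq_countP_add_countP (fun b => b == indicator L x)
      (l := l.map fun ω => f (x, trainingSet L ω.1) ω.2)
    have h₃ : (l.map fun ω => f (x, trainingSet L ω.1) ω.2).countP
        (fun a => decide ¬(a == indicator L x) = true) =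
        (l.map fun ω => f (x, trainingSet L ω.1) ω.2).count (!indicator L x) := by
      rw [List.count]
      refine List.countP_congr fun b _ => ?_
      cases b <;> cases indicator L x <;> simp
    rw [h₃, h₁, List.length_map, hl] at h₂
    rw [h₁]
    change _ < List.countP _ _
    omega

/-! ### A machine that gathers the advice from the examples -/

/-- The additional stacks of `gatherTM`: the input, the word `x` (reversed), the index of the next
bit of the advice, scratch copies of that index and of its successor, and the gathered advice. -/
inductive GatherStack
  | input | word | index | index' | succ' | advice
  deriving DecidableEq

instance : Fintype GatherStack :=
  ⟨{.input, .word, .index, .index', .succ', .advice}, fun k => by cases k <;> simp⟩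

/-- The additional labels of `gatherTM`. -/
inductive GatherLabel (Q : Type)
  | read (q : Q) | start | compare | back | finish | word | clear (b : Bool)
  deriving Fintype

/-- The additional registers of `gatherTM`. -/
@[ext] structure GatherReg where
  s₁ : Option (Option Bool) := none
  s₂ : Option (Option Bool) := none
  s₃ : Option (Option Bool) := none
  bit : Bool := false
  ok : Bool := false
  carry : Bool := false
  deriving Fintype

/-- The contents of the additional stacks of `gatherTM`. -/
def gatherStacks (i x e t u a : List (Option Bool)) : GatherStack → List (Option Bool)
  | .input => i
  | .word => x
  | .index => e
  | .index' => t
  | .succ' => u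
  | .advice => a

section GatherStacks

variable (i x e t u a s : List (Option Bool))

@[simp] theorem gatherStacks_input : gatherStacks i x e t u a .input = i := rfl
@[simp] theorem gatherStacks_word : gatherStacks i x e t u a .word = x := rfl
@[simp] theorem gatherStacks_index : gatherStacks i x e t u a .index = e := rfl
@[simp] theorem gatherStacks_index' : gatherStacks i x e t u a .index' = t := rfl
@[simp] theorem gatherStacks_succ' : gatherStacks i x e t u a .succ' = u := rfl
@[simp] theorem gatherStacks_advice : gatherStacks i x e t u a .advice = a := rfl

@[simp] theorem update_gatherStacks_input :
    Function.update (gatherStacks i x e t u a) .input s = gatherStacks s x e t u a := by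
  funext k; cases k <;> rfl
@[simp] theorem update_gatherStacks_word :
    Function.update (gatherStacks i x e t u a) .word s = gatherStacks i s e t u a := by
  funext k; cases k <;> rfl
@[simp] theorem update_gatherStacks_index :
    Function.update (gatherStacks i x e t u a) .index s = gatherStacks i x s t u a := by
  funext k; cases k <;> rfl
@[simp] theorem update_gatherStacks_index' :
    Function.update (gatherStacks i x e t u a) .index' s = gatherStacks i x e s u a := by
  funext k; cases k <;> rfl
@[simp] theorem update_gatherStacks_succ' :
    Function.update (gatherStacks i x e t u a) .succ' s = gatherStacks i x e t s a := by
  funext k; cases k <;> rfl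
@[simp] theorem update_gatherStacks_advice :
    Function.update (gatherStacks i x e t u a) .advice s = gatherStacks i x e t u s := by
  funext k; cases k <;> rfl

theorem gatherStacks_nil_input (s : List (Option Bool)) :
    gatherStacks s [] [] [] [] [] = only GatherStack.input s := by
  funext k; cases k <;> rfl

end GatherStacks

section GatherTM

variable (M : FinTM2) (ia : M.Γ M.k₀ ≃ Option Bool) (oa : M.Γ M.k₁ ≃ Bool) {Q : Type}
  (δ : Q → Bool → Q) (out : Q → Option Bool)

/-- The program of `gatherTM`. -/
def gatherProgram : M.Λ ⊕ GatherLabel Q →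
    LargeStmt GatherStack M.Γ M.Λ (GatherLabel Q) M.σ GatherReg
  | .inl l => liftStmt .halt (M.m l)
  | .inr (.read q) => popR .input (fun w s => { w with s₁ := s }) <|
      branchR (fun w => w.s₁ = some (some true))
        (pushR .word (fun _ => some true) <| pushR .index (fun _ => some false) <|
          loadR (fun _ => {}) <| gotoR (.read (δ q true))) <|
      branchR (fun w => w.s₁ = some (some false))
        (pushR .word (fun _ => some false) <| pushR .index (fun _ => some false) <|
          loadR (fun _ => {}) <| gotoR (.read (δ q false))) <|
      loadR (fun _ => {}) <|
      match out q with
      | some b => gotoR (.clear b)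
      -- One index digit is dropped: the index has one digit fewer than `x`, as the first letter of
      -- an example is the advice bit.
      | none => popR .index (fun w _ => w) <| gotoR .start
  | .inr .start => popR .input (fun w s => { w with s₁ := s }) <|
      branchR (fun w => w.s₁.join.isSome)
        (loadR (fun w => { bit := w.s₁.join = some true, ok := true, carry := true }) <|
          gotoR .compare) <|
      branchR (fun w => w.s₁.isSome)
        (popR .input (fun w _ => w) <| popR .input (fun w _ => w) <|
          loadR (fun _ => {}) <| gotoR .start)
        (loadR (fun _ => {}) <| gotoR .finish)
  -- While comparing, the counter is saved both unchanged and incremented; `back` restores the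
  -- version that the comparison calls for. The label of the example is popped unread.
  | .inr .compare => popR .input (fun w s => { w with s₁ := s }) <|
      branchR (fun w => w.s₁.join.isSome)
        (popR .index (fun w s => { w with s₂ := s }) <|
          branchR (fun w => w.s₂.isSome)
            (pushR .index' (fun w => w.s₂.join) <|
              pushR .succ' (fun w => w.s₂.join.map (· ^^ w.carry)) <|
              loadR (fun w => { bit := w.bit, ok := w.ok && w.s₁ = w.s₂,
                                carry := w.carry && w.s₂ = some (some true) }) <|
              gotoR .compare)
            (loadR (fun w => { bit := w.bit, ok := false, carry := w.carry }) <| gotoR .compare))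
        (peekR .index (fun w s => { w with s₂ := s }) <|
          loadR (fun w => { bit := w.bit, ok := w.ok && w.s₂.isNone, carry := false }) <|
          popR .input (fun w _ => w) <| popR .input (fun w _ => w) <| gotoR .back)
  | .inr .back => popR .index' (fun w s => { w with s₁ := s }) <|
      popR .succ' (fun w s => { w with s₂ := s }) <|
      branchR (fun w => w.s₁.isSome)
        (pushR .index (fun w => if w.ok then w.s₂.join else w.s₁.join) <|
          loadR (fun w => { bit := w.bit, ok := w.ok }) <| gotoR .back)
        (branchR (fun w => w.ok)
          (pushR .advice (fun w => some w.bit) <| loadR (fun _ => {}) <| gotoR .start)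
          (loadR (fun _ => {}) <| gotoR .start))
  | .inr .finish => popR .advice (fun w s => { w with s₁ := s }) <|
      branchR (fun w => w.s₁.isSome)
        (pushL M.k₀ (fun v => ia.symm v.2.s₁.join) <| loadR (fun _ => {}) <| gotoR .finish)
        (pushL M.k₀ (fun _ => ia.symm none) <| loadR (fun _ => {}) <| gotoR .word)
  | .inr .word => popR .word (fun w s => { w with s₁ := s }) <|
      popR .index (fun w s => { w with s₂ := s }) <|
      branchR (fun w => w.s₁.isSome)
        (pushL M.k₀ (fun v => ia.symm v.2.s₁.join) <| loadR (fun _ => {}) <| gotoR .word)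
        (branchR (fun w => w.s₂.isSome)
          (loadR (fun _ => {}) <| gotoR .word)
          (loadR (fun _ => {}) <| gotoL M.main))
  | .inr (.clear b) => popR .input (fun w s => { w with s₁ := s }) <|
      popR .word (fun w s => { w with s₂ := s }) <| popR .index (fun w s => { w with s₃ := s }) <|
      branchR (fun w => w.s₁.isSome || w.s₂.isSome || w.s₃.isSome)
        (loadR (fun _ => {}) <| gotoR (.clear b))
        (loadR (fun _ => {}) <| pushL M.k₁ (fun _ => oa.symm b) .halt)

/-- The machine that reads `x # e₁ ⋯ eₘ`, decides the membership of short words `x` with the finite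
automaton given by `δ` and `out`, and runs `M` on the input `x # a` for the other words, where `a`
is the advice that is gathered from the examples. -/
def gatherTM [Fintype Q] (q₀ : Q) : ProbTM where
  K := M.K ⊕ GatherStack
  kDecidableEq := inferInstance
  kFin := letI := M.kFin; inferInstance
  k₀ := .inr .input
  k₁ := .inl M.k₁
  Γ := Alphabet GatherStack M.Γ
  Λ := M.Λ ⊕ GatherLabel Q
  main := .inr (.read q₀)
  ΛFin := letI := M.ΛFin; inferInstance
  σ := M.σ × GatherReg
  initialState := (M.initialState, {})
  σFin := letI := M.σFin; inferInstance
  Γk₀Fin := inferInstanceAs (Fintype (Option Bool))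
  m := gatherProgram M ia oa δ out
  mTrue := gatherProgram M ia oa δ out

/-- Add `carry` to the binary number `l`, whose first digit is the lowest one, keeping its
length. -/
def addCarry (carry : Bool) : List Bool → List Bool
  | [] => []
  | b :: l => (b ^^ carry) :: addCarry (carry && b) l

/-- Process an example, where `s.1` is the index of the next bit of the advice and `s.2` is the
gathered advice (reversed). -/
def gather (s : List Bool × List Bool) (e : List Bool × Bool) : List Bool × List Bool :=
  match e.1 with
  | [] => s
  | d :: w => if w = s.1 then (addCarry true s.1, d :: s.2) else s

@[simp] theorem length_addCarry (c : Bool) (l : List Bool) : (addCarry c l).length = l.length := by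
  induction l generalizing c with
  | nil => rfl
  | cons b l ih => simp [addCarry, ih]

/-- A step of `gatherTM`. -/
def gatherStep :
    TM2.Cfg (Alphabet GatherStack M.Γ) (M.Λ ⊕ GatherLabel Q) (M.σ × GatherReg) →
    Option (TM2.Cfg (Alphabet GatherStack M.Γ) (M.Λ ⊕ GatherLabel Q) (M.σ × GatherReg)) :=
  TM2.step (gatherProgram M ia oa δ out)

variable {M ia oa δ out}

theorem gatherStep_largeCfg (l : M.Λ ⊕ GatherLabel Q) (v : M.σ) (w : GatherReg)
    (S : ∀ k, List (M.Γ k)) (R : GatherStack → List (Option Bool)) :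
    gatherStep M ia oa δ out (largeCfg (some l) v w S R) =
      some (exec (gatherProgram M ia oa δ out l) v w S R) :=
  rfl

/-! ### Loops of the gathering machine -/

section Loops

variable {v : M.σ} {S : ∀ k, List (M.Γ k)}

theorem gatherTM_read (x : List Bool) (rest w e : List (Option Bool)) (q : Q) :
    Within (gatherStep M ia oa δ out) (x.length)
      (largeCfg (some (.inr (.read q))) v {} S
        (gatherStacks (x.map some ++ none :: rest) w e [] [] []))
      (largeCfg (some (.inr (.read (x.foldl δ q)))) v {} S
        (gatherStacks (none :: rest) (x.reverse.map some ++ w)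
          (List.replicate x.length (some false) ++ e) [] [] [])) := by
  induction x generalizing w e q with
  | nil => simpa using Within.refl
  | cons b x ih =>
    refine Within.head (b := largeCfg (some (.inr (.read (δ q b)))) v {} S
      (gatherStacks (x.map some ++ none :: rest) (some b :: w) (some false :: e) [] [] [])) ?_ ?_
    · rw [gatherStep_largeCfg]
      cases b <;> simp [gatherProgram]
    · have := ih (some b :: w) (some false :: e) (δ q b)
      have h : List.replicate x.length (some false) ++ some false :: e =
          List.replicate (x.length + 1) (some false) ++ e := by
        rw [List.replicate_succ', List.append_assoc]; rfl
      rw [h] at this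
      simpa using this

theorem gatherTM_clear (b : Bool) (i x e : List (Option Bool)) {n : ℕ}
    (hi : i.length ≤ n) (hx : x.length ≤ n) (he : e.length ≤ n) :
    Within (gatherStep M ia oa δ out) (n + 1)
      (largeCfg (some (.inr (.clear b))) v {} (fun _ => []) (gatherStacks i x e [] [] []))
      (largeCfg none v {} (only M.k₁ [oa.symm b]) (gatherStacks [] [] [] [] [] [])) := by
  induction n generalizing i x e with
  | zero =>
    obtain rfl : i = [] := by simpa using hi
    obtain rfl : x = [] := by simpa using hx
    obtain rfl : e = [] := by simpa using he
    refine Within.head ?_ .refl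
    rw [gatherStep_largeCfg]
    simp [gatherProgram]
  | succ n ih =>
    have := ih i.tail x.tail e.tail (by simp; omega) (by simp; omega) (by simp; omega)
    by_cases h : i = [] ∧ x = [] ∧ e = []
    · obtain ⟨rfl, rfl, rfl⟩ := h
      refine Within.head ?_ .refl
      rw [gatherStep_largeCfg]
      simp [gatherProgram]
    · refine Within.head ?_ this
      rw [gatherStep_largeCfg]
      cases i <;> cases x <;> cases e <;> simp [gatherProgram] at h ⊢

/-- Stated for words of any length: if `w` is longer than the index, `ok` is cleared; if it is
shorter, the unread digits stay in place. -/
theorem gatherTM_compare (w e : List Bool) (rest x t u a : List (Option Bool)) (d b ok c : Bool) :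
    Within (gatherStep M ia oa δ out) (w.length + 1)
      (largeCfg (some (.inr .compare)) v { bit := d, ok := ok, carry := c } S
        (gatherStacks (w.map some ++ none :: some b :: none :: rest) x (e.map some) t u a))
      (largeCfg (some (.inr .back)) v { bit := d, ok := ok && decide (w = e) } S
        (gatherStacks rest x ((e.drop w.length).map some)
          ((e.take w.length).reverse.map some ++ t)
          (((addCarry c e).take w.length).reverse.map some ++ u) a)) := by
  induction w generalizing e t u ok c with
  | nil =>
    refine Within.head ?_ .refl
    rw [gatherStep_largeCfg]
    cases e <;> simp [gatherProgram]
  | cons y w ih =>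
    cases e with
    | nil =>
      have := ih [] t u false c
      refine Within.head ?_ (by simpa [addCarry] using this)
      rw [gatherStep_largeCfg]
      simp [gatherProgram]
    | cons z e =>
      have := ih e (some z :: t) (some (z ^^ c) :: u) (ok && (y == z)) (c && z)
      have h : (ok && (y == z) && decide (w = e)) = (ok && decide (y :: w = z :: e)) := by
        rw [Bool.and_assoc]
        by_cases h₁ : y = z <;> by_cases h₂ : w = e <;> simp [h₁, h₂]
      rw [h] at this
      refine Within.head ?_ (by simpa [addCarry] using this)
      rw [gatherStep_largeCfg]
      simp [gatherProgram]
      cases y <;> cases z <;> cases c <;> rfl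

theorem gatherTM_back (t u : List Bool) (htu : t.length = u.length)
    (i x e a : List (Option Bool)) (d ok : Bool) :
    Within (gatherStep M ia oa δ out) (t.length + 1)
      (largeCfg (some (.inr .back)) v { bit := d, ok := ok } S
        (gatherStacks i x e (t.map some) (u.map some) a))
      (largeCfg (some (.inr .start)) v {} S
        (gatherStacks i x ((if ok then u else t).reverse.map some ++ e) [] []
          (if ok then some d :: a else a))) := by
  induction t generalizing u e with
  | nil =>
    obtain rfl : u = [] := by simpa [eq_comm] using htu
    refine Within.head ?_ .refl
    rw [gatherStep_largeCfg]
    cases ok <;> simp [gatherProgram]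
  | cons b t ih =>
    cases u with
    | nil => simp at htu
    | cons c u =>
      have := ih u (by simpa using htu) (some (if ok then c else b) :: e)
      refine Within.head (b := largeCfg (some (.inr .back)) v { bit := d, ok := ok } S
        (gatherStacks i x (some (if ok then c else b) :: e) (t.map some) (u.map some) a)) ?_ ?_
      · rw [gatherStep_largeCfg]
        cases ok <;> simp [gatherProgram]
      · cases ok <;> simpa using this

theorem gatherTM_example (s : List Bool × List Bool) (ex : List Bool × Bool)
    (rest x : List (Option Bool)) :
    Within (gatherStep M ia oa δ out) (2 * (encodeExample ex).length)
      (largeCfg (some (.inr .start)) v {} S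
        (gatherStacks (encodeExample ex ++ rest) x (s.1.map some) [] [] (s.2.map some)))
      (largeCfg (some (.inr .start)) v {} S
        (gatherStacks rest x ((gather s ex).1.map some) [] [] ((gather s ex).2.map some))) := by
  obtain ⟨e, a⟩ := s
  obtain ⟨_ | ⟨d, w⟩, b⟩ := ex
  · refine (Within.head (n := 0) ?_ .refl).mono (by simp [encodeExample])
    rw [gatherStep_largeCfg]
    simp [gatherProgram, encodeExample, gather]
  · have h₁ := gatherTM_compare (M := M) (ia := ia) (oa := oa) (δ := δ) (out := out) (v := v)
      (S := S) w e rest x [] [] (a.map some) d b true true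
    have h₂ := gatherTM_back (M := M) (ia := ia) (oa := oa) (δ := δ) (out := out) (v := v)
      (S := S) (e.take w.length).reverse ((addCarry true e).take w.length).reverse (by simp)
      rest x ((e.drop w.length).map some) (a.map some) d (decide (w = e))
    refine (Within.head ?_ (h₁.trans (n := w.length + 1) ?_)).mono ?_
    · rw [gatherStep_largeCfg]
      simp [gatherProgram, encodeExample]
    · refine Within.mono ?_ (show (e.take w.length).reverse.length + 1 ≤ w.length + 1 by simp)
      by_cases h : w = e
      · subst h
        have ht : (addCarry true w).take w.length = addCarry true w :=
          List.take_of_length_le (by simp)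
        rw [ht] at h₂ ⊢
        simpa [gather] using h₂
      · simpa [gather, h, ← List.map_take, ← List.map_drop, ← List.map_append] using h₂
    · simp [encodeExample]; omega

theorem gatherTM_examples (es : List (List Bool × Bool)) (s : List Bool × List Bool)
    (x : List (Option Bool)) :
    Within (gatherStep M ia oa δ out) (2 * (es.flatMap encodeExample).length + 1)
      (largeCfg (some (.inr .start)) v {} S
        (gatherStacks (es.flatMap encodeExample) x (s.1.map some) [] [] (s.2.map some)))
      (largeCfg (some (.inr .finish)) v {} S
        (gatherStacks [] x ((es.foldl gather s).1.map some) [] []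
          ((es.foldl gather s).2.map some))) := by
  induction es generalizing s with
  | nil =>
    refine Within.head (n := 0) ?_ .refl
    rw [gatherStep_largeCfg]
    simp [gatherProgram]
  | cons ex es ih =>
    have := (gatherTM_example (M := M) (ia := ia) (oa := oa) (δ := δ) (out := out) (v := v)
      (S := S) s ex (es.flatMap encodeExample) x).trans (ih _)
    simp only [List.flatMap_cons, List.foldl_cons, List.length_append]
    exact this.mono (by omega)

/-- The advice was gathered with its last bit on top, so moving it bit by bit onto the input stack
of `M` puts it in the right order; the separator then goes above it. -/
theorem gatherTM_finish (a : List Bool) (x e : List (Option Bool)) (l : List (M.Γ M.k₀)) :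
    Within (gatherStep M ia oa δ out) (a.length + 1)
      (largeCfg (some (.inr .finish)) v {} (only M.k₀ l)
        (gatherStacks [] x e [] [] (a.map some)))
      (largeCfg (some (.inr .word)) v {}
        (only M.k₀ (ia.symm none :: ((a.reverse.map fun b => ia.symm (some b)) ++ l)))
        (gatherStacks [] x e [] [] [])) := by
  induction a generalizing l with
  | nil =>
    refine Within.head ?_ .refl
    rw [gatherStep_largeCfg]
    simp [gatherProgram]
  | cons b a ih =>
    refine Within.head (b := largeCfg (some (.inr .finish)) v {}
      (only M.k₀ (ia.symm (some b) :: l)) (gatherStacks [] x e [] [] (a.map some))) ?_ ?_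
    · rw [gatherStep_largeCfg]
      simp [gatherProgram]
    · simpa using ih (ia.symm (some b) :: l)

theorem gatherTM_word (x : List Bool) (e : List (Option Bool)) (l : List (M.Γ M.k₀)) {n : ℕ}
    (hx : x.length ≤ n) (he : e.length ≤ n) :
    Within (gatherStep M ia oa δ out) (n + 1)
      (largeCfg (some (.inr .word)) v {} (only M.k₀ l)
        (gatherStacks [] (x.map some) e [] [] []))
      (largeCfg (some (.inl M.main)) v {}
        (only M.k₀ ((x.reverse.map fun b => ia.symm (some b)) ++ l))
        (gatherStacks [] [] [] [] [] [])) := by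
  induction n generalizing x e l with
  | zero =>
    obtain rfl : x = [] := by simpa using hx
    obtain rfl : e = [] := by simpa using he
    refine Within.head ?_ .refl
    rw [gatherStep_largeCfg]
    simp [gatherProgram]
  | succ n ih =>
    cases x with
    | nil =>
      cases e with
      | nil =>
        refine Within.head ?_ .refl
        rw [gatherStep_largeCfg]
        simp [gatherProgram]
      | cons d e =>
        refine Within.head ?_ (ih [] e l (by simp) (by simpa using he))
        rw [gatherStep_largeCfg]
        simp [gatherProgram]
    | cons b x =>
      have := ih x e.tail (ia.symm (some b) :: l) (by simpa using hx) (by simp; omega)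
      refine Within.head ?_ (by simpa using this)
      rw [gatherStep_largeCfg]
      simp [gatherProgram]

theorem gatherTM_run {c c' : M.Cfg} {t : ℕ} {R : GatherStack → List (Option Bool)}
    (h : StepsIn M.step t c c') :
    StepsIn (gatherStep M ia oa δ out) t (liftCfg none {} R c) (liftCfg none {} R c') := by
  induction t generalizing c with
  | zero =>
    cases h
    rfl
  | succ t ih =>
    obtain ⟨d, hd, h⟩ := h
    refine ⟨_, ?_, ih h⟩
    rcases c with ⟨_ | l, u, T⟩
    · cases hd
    · cases hd
      change gatherStep M ia oa δ out (largeCfg (some (.inl l)) _ _ _ _) = _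
      rw [gatherStep_largeCfg]
      have he : ∀ v w S R, exec (Γ := M.Γ) (Λ := M.Λ) (TM2.Stmt.halt :
          LargeStmt GatherStack M.Γ M.Λ (GatherLabel Q) M.σ GatherReg) v w S R =
          largeCfg none v w S R := fun v w S R => rfl
      exact congrArg some (exec_liftStmt he _ _ _ _ _)

end Loops

end GatherTM

theorem ProbTM.run_eq_iterate (M : ProbTM) (h : M.mTrue = M.m) (r : ℕ → Bool) (c : M.toFinTM2.Cfg)
    (t : ℕ) :
    M.run r c t = (flip bind M.toFinTM2.step)^[t] (some c : Option M.toFinTM2.Cfg) := by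
  induction t with
  | zero => rfl
  | succ t ih =>
    rw [Function.iterate_succ_apply', ← ih]
    have : M.coinStep (r t) = M.toFinTM2.step := by
      unfold ProbTM.coinStep
      simp only [h, ite_self]
      rfl
    simp only [ProbTM.run, this]
    rfl

theorem ProbTM.outputsInTime_of_within (M : ProbTM) (h : M.mTrue = M.m) (r : ℕ → Bool)
    {l : List (M.Γ M.k₀)} {l' : List (M.Γ M.k₁)} {T : ℕ}
    (hW : Within M.toFinTM2.step T (initList M.toFinTM2 l) (haltList M.toFinTM2 l')) :
    M.OutputsInTime r l l' T := by
  obtain ⟨t, ht, hs⟩ := hW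
  exact ⟨t, ht, (M.run_eq_iterate h r _ t).trans (stepsIn_iff_iterate.1 hs)⟩

/-! ### The function computed by the gathering machine -/

section GatherFun

variable {Q : Type} {δ : Q → Bool → Q} {out : Q → Option Bool} {q₀ : Q}
  {g : List Bool × List Bool → Bool}

/-- The function that is computed by `gatherTM`. -/
def gatherFun (g : List Bool × List Bool → Bool) (δ : Q → Bool → Q) (out : Q → Option Bool) (q₀ : Q)
    (z : List Bool × List (List Bool × Bool)) : Bool :=
  (out (z.1.foldl δ q₀)).getD
    (g (z.1, (z.2.foldl gather (List.replicate (z.1.length - 1) false, [])).2.reverse))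

theorem length_foldl_gather_le (es : List (List Bool × Bool)) (s : List Bool × List Bool) :
    (es.foldl gather s).1.length = s.1.length ∧
      (es.foldl gather s).2.length ≤ s.2.length + es.length := by
  induction es generalizing s with
  | nil => simp
  | cons e es ih =>
    have h : (gather s e).1.length = s.1.length ∧ (gather s e).2.length ≤ s.2.length + 1 := by
      obtain ⟨_ | ⟨d, w⟩, b⟩ := e
      · simp [gather]
      · by_cases hw : w = s.1 <;> simp [gather, hw]
    have := ih (gather s e)
    simp only [List.foldl_cons, List.length_cons]
    omega

theorem length_le_length_flatMap_encodeExample (es : List (List Bool × Bool)) :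
    es.length ≤ (es.flatMap encodeExample).length := by
  induction es with
  | nil => simp
  | cons e es ih =>
    rw [List.flatMap_cons, List.length_append, List.length_cons]
    simp only [encodeExample, List.length_append, List.length_cons]
    omega

/-- A bound for the running time of `gatherTM`. -/
noncomputable def gatherTime (time : Polynomial ℕ) : Polynomial ℕ :=
  7 * .X + time + 7

theorem gatherFun_computable [Fintype Q]
    (hg : Nonempty (TM2ComputableInPolyTime encodePair Computability.encodeBool g)) :
    ProbComputableInPolyTime encodeWithExamples Computability.encodeBool
      (fun z _ => gatherFun g δ out q₀ z) := by
  obtain ⟨⟨⟨M, ia, oa⟩, time, hM⟩⟩ := hg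
  refine ⟨gatherTM M ia oa δ out q₀, Equiv.refl (Option Bool), oa, gatherTime time,
    fun ⟨x, es⟩ r => ProbTM.outputsInTime_of_within _ rfl r ?_⟩
  have hl : (encodeWithExamples (x, es)).length =
      x.length + 1 + (es.flatMap encodeExample).length := by
    simp only [encodeWithExamples, List.length_append, List.length_map, List.length_cons]
    omega
  have h₁ := gatherTM_read (M := M) (ia := ia) (oa := oa) (δ := δ) (out := out)
    (v := M.initialState) (S := fun _ => []) x (es.flatMap encodeExample) [] [] q₀
  rw [initList_eq, haltList_eq]
  have e₁ : (⟨some (gatherTM M ia oa δ out q₀).main, (gatherTM M ia oa δ out q₀).initialState,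
      only (gatherTM M ia oa δ out q₀).k₀
        ((encodeWithExamples (x, es)).map (Equiv.refl (Option Bool)).symm)⟩ :
      (gatherTM M ia oa δ out q₀).Cfg) = largeCfg (some (.inr (.read q₀))) M.initialState {}
        (fun _ => []) (gatherStacks (x.map some ++ none :: es.flatMap encodeExample)
          [] [] [] [] []) := by
    rw [gatherStacks_nil_input]
    unfold largeCfg
    rw [joinStacks_only_inr]
    exact congrArg (fun l => (⟨some (.inr (.read q₀)), (M.initialState, {}),
      only (Γ := Alphabet GatherStack M.Γ) (.inr .input) l⟩ :
      (gatherTM M ia oa δ out q₀).Cfg))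
      (List.map_id (x.map some ++ none :: es.flatMap encodeExample))
  have e₂ : ∀ b, (⟨none, (gatherTM M ia oa δ out q₀).initialState,
      only (gatherTM M ia oa δ out q₀).k₁ ((Computability.encodeBool b).map oa.symm)⟩ :
      (gatherTM M ia oa δ out q₀).Cfg) = largeCfg none M.initialState {}
        (only M.k₁ [oa.symm b]) (gatherStacks [] [] [] [] [] []) := by
    intro b
    rw [gatherStacks_nil_input, only_nil]
    unfold largeCfg
    rw [joinStacks_only_inl]
    rfl
  refine Eq.mpr (congrArg₂ (Within _ _) e₁ (e₂ (gatherFun g δ out q₀ (x, es)))) ?_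
  change Within (gatherStep M ia oa δ out) _ _ _
  have ht : (gatherTime time).eval (encodeWithExamples (x, es)).length =
      7 * (x.length + 1 + (es.flatMap encodeExample).length) +
        time.eval (x.length + 1 + (es.flatMap encodeExample).length) + 7 := by
    rw [hl]
    simp [gatherTime]
  rw [ht]
  cases hout : out (x.foldl δ q₀) with
  | some b =>
    have h₂ := gatherTM_clear (M := M) (ia := ia) (oa := oa) (δ := δ) (out := out)
      (v := M.initialState) b (es.flatMap encodeExample) (x.reverse.map some)
      (List.replicate x.length (some false)) (n := x.length + (es.flatMap encodeExample).length)
      (by omega) (by simp) (by simp)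
    have hg : gatherFun g δ out q₀ (x, es) = b := by simp [gatherFun, hout]
    rw [hg]
    refine (h₁.trans (Within.head ?_ h₂)).mono (by omega)
    rw [gatherStep_largeCfg]
    simp [gatherProgram, hout]
  | none =>
    obtain ⟨hle, hla⟩ := length_foldl_gather_le es (List.replicate (x.length - 1) false, [])
    have hes := length_le_length_flatMap_encodeExample es
    obtain ⟨st, hst⟩ : ∃ st, st = es.foldl gather (List.replicate (x.length - 1) false, []) :=
      ⟨_, rfl⟩
    have h₂ := gatherTM_examples (M := M) (ia := ia) (oa := oa) (δ := δ) (out := out)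
      (v := M.initialState) (S := fun _ => []) es (List.replicate (x.length - 1) false, [])
      (x.reverse.map some)
    rw [← hst] at h₂ hle hla
    simp only [List.length_replicate, List.length_nil] at hle hla
    have h₃ := gatherTM_finish (M := M) (ia := ia) (oa := oa) (δ := δ) (out := out)
      (v := M.initialState) st.2 (x.reverse.map some) (st.1.map some) []
    have h₄ := gatherTM_word (M := M) (ia := ia) (oa := oa) (δ := δ) (out := out)
      (v := M.initialState) x.reverse (st.1.map some)
      (ia.symm none :: ((st.2.reverse.map fun b => ia.symm (some b)) ++ [])) (n := x.length)
      (by simp) (by simp; omega)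
    obtain ⟨t, ht, h₅⟩ := within_iff_nonempty_evalsToInTime.2 ⟨hM (x, st.2.reverse)⟩
    have hg : gatherFun g δ out q₀ (x, es) = g (x, st.2.reverse) := by
      simp [gatherFun, hout, hst]
    rw [hg]
    have h₆ := gatherTM_run (ia := ia) (oa := oa) (δ := δ) (out := out)
      (R := gatherStacks [] [] [] [] [] []) h₅
    rw [initList_eq, haltList_eq] at h₆
    have hlen : (encodePair (x, st.2.reverse)).length = x.length + 1 + st.2.length := by
      simp [encodePair]; omega
    -- Each example yields at most one bit, so the input of `M` is no longer than the original
    -- input.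
    have hmono := polynomial_eval_mono time (show x.length + 1 + st.2.length ≤
      x.length + 1 + (es.flatMap encodeExample).length by omega)
    rw [hlen] at ht
    simp only at ht hmono
    have h₇ : StepsIn (gatherStep M ia oa δ out) t
        (largeCfg (some (.inl M.main)) M.initialState {}
          (only M.k₀ ((encodePair (x, st.2.reverse)).map ia.symm))
          (gatherStacks [] [] [] [] [] []))
        (largeCfg none M.initialState {} (only M.k₁ [oa.symm (g (x, st.2.reverse))])
          (gatherStacks [] [] [] [] [] [])) := h₆
    have e : (x.reverse.reverse.map fun b => ia.symm (some b)) ++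
        ia.symm none :: ((st.2.reverse.map fun b => ia.symm (some b)) ++ []) =
        (encodePair (x, st.2.reverse)).map ia.symm := by
      simp [encodePair, Function.comp_def]
    rw [e] at h₄
    rw [only_nil] at h₃
    refine Within.mono (h₁.trans (Within.head ?_
      (((h₂.trans h₃).trans h₄).trans ⟨t, le_rfl, h₇⟩))) ?_
    · rw [gatherStep_largeCfg]
      simp [gatherProgram, hout]
    · omega

end GatherFun

/-! ### Binary indices -/

/-- The value of a binary number whose first digit is the lowest one. -/
def binaryValue : List Bool → ℕ
  | [] => 0
  | b :: l => b.toNat + 2 * binaryValue l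

/-- Digit-wise induction; the hypothesis excludes an overflow beyond the fixed width. -/
theorem binaryValue_addCarry {c : Bool} {l : List Bool}
    (h : binaryValue l + c.toNat < 2 ^ l.length) :
    binaryValue (addCarry c l) = binaryValue l + c.toNat := by
  induction l generalizing c with
  | nil => cases c <;> simp [binaryValue, addCarry] at h ⊢
  | cons b l ih =>
    simp only [binaryValue, List.length_cons, pow_succ, addCarry] at h ⊢
    rw [ih (by cases b <;> cases c <;> simp at h ⊢ <;> omega)]
    cases b <;> cases c <;> simp <;> ring

/-- The binary number `j` with `k` digits. -/
def binaryIndex (k j : ℕ) : List Bool :=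
  (addCarry true)^[j] (List.replicate k false)

theorem binaryIndex_succ (k j : ℕ) : binaryIndex k (j + 1) = addCarry true (binaryIndex k j) :=
  Function.iterate_succ_apply' _ _ _

@[simp] theorem length_binaryIndex (k j : ℕ) : (binaryIndex k j).length = k := by
  induction j with
  | zero => simp [binaryIndex]
  | succ j ih => rw [binaryIndex_succ, length_addCarry, ih]

theorem binaryValue_binaryIndex {k j : ℕ} (h : j < 2 ^ k) : binaryValue (binaryIndex k j) = j := by
  induction j with
  | zero =>
    unfold binaryIndex
    rw [Function.iterate_zero, id]
    clear h
    induction k with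
    | zero => rfl
    | succ k ih => simp [List.replicate_succ, binaryValue, ih]
  | succ j ih =>
    have := ih (by omega)
    rw [binaryIndex_succ, binaryValue_addCarry (by simp [this]; omega), this]
    rfl

theorem binaryIndex_inj {k i j : ℕ} (hi : i < 2 ^ k) (hj : j < 2 ^ k)
    (h : binaryIndex k i = binaryIndex k j) : i = j := by
  rw [← binaryValue_binaryIndex hi, ← binaryValue_binaryIndex hj, h]

/-! ### Encoding the advice in examples -/

/-- The word of length `k + 1` that encodes the `j`-th bit of the advice `a`, or contains the index
`N` if there is no such bit. -/
def codeword (k N : ℕ) (a : List Bool) (j : ℕ) : List Bool :=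
  if j < a.length then a.getD j false :: binaryIndex k j else false :: binaryIndex k N

@[simp] theorem length_codeword (k N : ℕ) (a : List Bool) (j : ℕ) :
    (codeword k N a j).length = k + 1 := by
  unfold codeword
  split_ifs <;> simp

/-- The state after the first `c` bits of the advice have been gathered. -/
def gathered (k : ℕ) (a : List Bool) (c : ℕ) : List Bool × List Bool :=
  (binaryIndex k c, (a.take c).reverse)

/-- All indices involved are below `2 ^ k` and hence distinct in binary. The dummy index `N` exceeds
every value `c ≤ a.length` of the counter, so dummies are skipped. -/
theorem gather_codeword {k N : ℕ} {a : List Bool} (hN : N < 2 ^ k) (ha : a.length < N) {c : ℕ}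
    (hc : c ≤ a.length) (j : ℕ) (b : Bool) :
    gather (gathered k a c) (codeword k N a j, b) =
      gathered k a (if j = c ∧ c < a.length then c + 1 else c) := by
  unfold codeword
  split_ifs with h₁ h₂ h₂
  · obtain ⟨rfl, h₂⟩ := h₂
    have ht : (a.take (j + 1)).reverse = a.getD j false :: (a.take j).reverse := by
      rw [List.take_add_one, List.getElem?_eq_getElem h₂]
      simp [h₂]
    simp only [gather, gathered, if_true, binaryIndex_succ, ht]
  · have : binaryIndex k j ≠ binaryIndex k c := fun h =>
      h₂ (by have := binaryIndex_inj (by omega) (by omega) h; omega)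
    simp [gather, gathered, this]
  · omega
  · have : binaryIndex k N ≠ binaryIndex k c := fun h => by
      have := binaryIndex_inj (by omega) (by omega) h; omega
    simp [gather, gathered, this]

theorem codeword_inj {k N : ℕ} {a : List Bool} (hN : N < 2 ^ k) (ha : a.length < N) {i j : ℕ}
    (hi : i < a.length) (h : codeword k N a j = codeword k N a i) : j = i := by
  unfold codeword at h
  rw [if_pos hi] at h
  split_ifs at h with hj
  · exact binaryIndex_inj (by omega) (by omega) (List.cons.inj h).2
  · have := binaryIndex_inj (by omega) (by omega) (List.cons.inj h).2
    omega

/-! ### Gathering from a stream of examples -/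

/-- The number of bits that have been gathered after `t` examples, where the example `t` carries the
bit `J t`, and there are `n` bits in total. -/
def progress (J : ℕ → ℕ) (n : ℕ) : ℕ → ℕ
  | 0 => 0
  | t + 1 => if J t = progress J n t ∧ progress J n t < n then progress J n t + 1
      else progress J n t

theorem progress_le (J : ℕ → ℕ) (n t : ℕ) : progress J n t ≤ n := by
  induction t with
  | zero => exact n.zero_le
  | succ t ih =>
    simp only [progress]
    split_ifs <;> omega

theorem progress_mono (J : ℕ → ℕ) (n : ℕ) : Monotone (progress J n) := by
  refine monotone_nat_of_le_succ fun t => ?_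
  simp only [progress]
  split_ifs <;> omega

/-- At the start of block `j` at least `j` bits are known. When bit `j` appears in that block,
either it is the next one and is taken, or the counter has already passed it. -/
theorem le_progress {J : ℕ → ℕ} {n B : ℕ}
    (h : ∀ j < n, ∃ t, B * j ≤ t ∧ t < B * (j + 1) ∧ J t = j) {j : ℕ} (hj : j ≤ n) :
    j ≤ progress J n (B * j) := by
  induction j with
  | zero => exact Nat.zero_le _
  | succ j ih =>
    obtain ⟨t, ht, ht', hJ⟩ := h j hj
    have h₁ := (ih (by omega)).trans (progress_mono J n ht)
    have h₂ : j + 1 ≤ progress J n (t + 1) := by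
      simp only [progress]
      split_ifs <;> omega
    exact h₂.trans (progress_mono J n ht')

theorem foldl_gather_eq {k N m : ℕ} {a : List Bool} (hN : N < 2 ^ k) (ha : a.length < N)
    {es : List (List Bool × Bool)} {J : ℕ → ℕ} (hes : es.length = m)
    (hJ : ∀ t (h : t < es.length), es[t].1 = codeword k N a (J t)) :
    es.foldl gather (gathered k a 0) = gathered k a (progress J a.length m) := by
  subst hes
  suffices H : ∀ t ≤ es.length, (es.take t).foldl gather (gathered k a 0) =
      gathered k a (progress J a.length t) by
    simpa using H es.length le_rfl
  intro t ht
  induction t with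
  | zero => rfl
  | succ t ih =>
    rw [List.take_add_one, List.getElem?_eq_getElem ht, Option.toList_some, List.foldl_append,
      ih (by omega), List.foldl_cons, List.foldl_nil]
    have : es[t] = (codeword k N a (J t), es[t].2) := Prod.ext (hJ t ht) rfl
    rw [this, gather_codeword hN ha (progress_le _ _ _)]
    rfl

theorem ofFn_getD {n : ℕ} {l : List Bool} (h : l.length = n) :
    (List.ofFn fun i : Fin n => l.getD i false) = l := by
  subst h
  exact List.ext_getElem (by simp) fun i h₁ h₂ => by simp

/-- If all the sample points are codewords, and the `j`-th codeword is among those in the `j`-th of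
`M` blocks of length `B`, then the advice is gathered from the training set. -/
theorem foldl_gather_trainingSet (L : Language Bool) {k N M B : ℕ} {a : List Bool}
    (hN : N < 2 ^ k) (ha : a.length < N) (haM : a.length ≤ M) {code : Fin M → Fin (k + 1) → Bool}
    (hcode : ∀ j, List.ofFn (code j) = codeword k N a j)
    {s : Fin (M * B) → Fin (k + 1) → Bool} (hs : ∀ i, ∃ j, s i = code j)
    (hhit : ∀ j, ∃ t, s (finProdFinEquiv (j, t)) = code j) :
    ((trainingSet L s).foldl gather (List.replicate k false, [])).2.reverse = a := by
  choose J hJ using hs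
  let J' : ℕ → ℕ := fun t => if h : t < M * B then J ⟨t, h⟩ else 0
  have h : (trainingSet L s).foldl gather (gathered k a 0) =
      gathered k a (progress J' a.length (M * B)) := by
    refine foldl_gather_eq hN ha (length_trainingSet L s) fun t ht => ?_
    rw [length_trainingSet] at ht
    simp only [trainingSet, List.getElem_ofFn, J', ht, dif_pos]
    rw [hJ, hcode]
  have hp : a.length ≤ progress J' a.length (M * B) := by
    refine (le_progress (J := J') (B := B) (fun j hj => ?_) le_rfl).trans
      (progress_mono _ _ ?_)
    · obtain ⟨t, ht⟩ := hhit ⟨j, by omega⟩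
      have hv : (finProdFinEquiv ((⟨j, by omega⟩ : Fin M), t) : ℕ) = t + B * j := rfl
      refine ⟨t + B * j, by omega, by have := t.2; rw [Nat.mul_add]; omega, ?_⟩
      have hlt : t + B * j < M * B := hv ▸ (finProdFinEquiv ((⟨j, by omega⟩ : Fin M), t)).2
      simp only [J', hlt, dif_pos]
      -- `J` was chosen arbitrarily and dummy codewords coincide, but the codeword of a genuine bit
      -- determines its index.
      refine codeword_inj hN ha hj ?_
      rw [← hcode, ← hJ, show (⟨t + B * j, hlt⟩ : Fin (M * B)) =
        finProdFinEquiv ((⟨j, by omega⟩ : Fin M), t) from Fin.ext hv.symm, ht, hcode]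
    · rw [mul_comm]
      exact Nat.mul_le_mul_right _ haM
  change ((trainingSet L s).foldl gather (gathered k a 0)).2.reverse = a
  rw [h]
  simp [gathered, List.take_of_length_le hp]

/-! ### Sampling all the codewords -/

/-- With high probability, independent samples from a distribution on the values of `code` that
gives each of them probability at least `1 / M` contain `code j` in the `j`-th of `M` blocks. -/
theorem le_sampleLaw_hit {n M B : ℕ} (hM : 0 < M) (hB : B = 3 * M ^ 2) (D : PMF (Fin n → Bool))
    (code : Fin M → Fin n → Bool) (hD : ∀ j, (M : ENNReal)⁻¹ ≤ D (code j))
    (hsupp : D.support ⊆ Set.range code) :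
    2 / 3 ≤ sampleLaw D (M * B) {s | (∀ i, ∃ j, s i = code j) ∧
      ∀ j, ∃ t, s (finProdFinEquiv (j, t)) = code j} := by
  have hmeas : ∀ A : Set (Fin (M * B) → Fin n → Bool), MeasurableSet A := fun A =>
    (Set.toFinite A).measurableSet
  have hmeas' : ∀ A : Set (Fin n → Bool), MeasurableSet A := fun A => (Set.toFinite A).measurableSet
  set G : Set (Fin (M * B) → Fin n → Bool) := {s | (∀ i, ∃ j, s i = code j) ∧
      ∀ j, ∃ t, s (finProdFinEquiv (j, t)) = code j} with hG
  have hsub : Gᶜ ⊆ (⋃ i, {s : Fin (M * B) → Fin n → Bool | s i ∉ Set.range code}) ∪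
      ⋃ j, {s | ∀ t, s (finProdFinEquiv (j, t)) ≠ code j} := by
    intro s hs
    by_contra h
    simp only [Set.mem_union, Set.mem_iUnion, Set.mem_ofPred_eq, not_or, not_exists, not_not,
      not_forall] at h
    refine hs ⟨fun i => ?_, fun j => ?_⟩
    · obtain ⟨j, hj⟩ := h.1 i
      exact ⟨j, hj.symm⟩
    · exact h.2 j
  have h₁ : ∀ i, sampleLaw D (M * B) {s | s i ∉ Set.range code} = 0 := by
    intro i
    have : sampleLaw D (M * B) {s | s i ∉ Set.range code} = D.toMeasure (Set.range code)ᶜ :=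
      (measurePreserving_eval (fun _ => D.toMeasure) i).measure_preimage
        (hmeas' (Set.range code)ᶜ).nullMeasurableSet
    rw [this, PMF.toMeasure_apply_eq_zero_iff _ (hmeas' _)]
    exact Set.disjoint_compl_right_iff_subset.2 hsupp
  have h₂ : ∀ j, (sampleLaw D (M * B)).real {s | ∀ t, s (finProdFinEquiv (j, t)) ≠ code j} ≤
      (1 - 1 / (M : ℝ)) ^ B := by
    intro j
    -- Missing `code j` constrains only the coordinates of block `j`; as a box, the event has a
    -- product probability.
    have e : {s : Fin (M * B) → Fin n → Bool | ∀ t, s (finProdFinEquiv (j, t)) ≠ code j} =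
        Set.pi Set.univ fun i =>
          if (finProdFinEquiv.symm i).1 = j then {code j}ᶜ else Set.univ := by
      ext s
      simp only [Set.mem_ofPred_eq, Set.mem_pi, Set.mem_univ, true_imp_iff]
      constructor
      · intro h i
        split_ifs with hi
        · have := h (finProdFinEquiv.symm i).2
          have e : finProdFinEquiv (j, (finProdFinEquiv.symm i).2) = i := by
            rw [← hi]
            exact finProdFinEquiv.apply_symm_apply i
          rw [e] at this
          exact this
        · trivial
      · intro h t
        simpa using h (finProdFinEquiv (j, t))
    have hc : D.toMeasure.real {code j}ᶜ ≤ 1 - 1 / (M : ℝ) := by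
      rw [probReal_compl_eq_one_sub (hmeas' _)]
      have h := hD j
      have : 1 / (M : ℝ) ≤ D.toMeasure.real {code j} := by
        unfold Measure.real
        rw [PMF.toMeasure_apply_singleton _ _ (hmeas' _)]
        have := ENNReal.toReal_mono (D.apply_ne_top _) h
        simpa using this
      linarith
    have hp : (sampleLaw D (M * B)).real
        {s | ∀ t, s (finProdFinEquiv (j, t)) ≠ code j} = D.toMeasure.real {code j}ᶜ ^ B := by
      rw [e]
      unfold Measure.real sampleLaw
      rw [Measure.pi_pi, ← finProdFinEquiv.prod_comp, Fintype.prod_prod_type]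
      simp only [Equiv.symm_apply_apply, Finset.prod_const, Finset.card_univ, Fintype.card_fin]
      rw [Finset.prod_eq_single j (fun i _ hi => by simp [hi]) (by simp)]
      simp
    rw [hp]
    exact pow_le_pow_left₀ measureReal_nonneg hc _
  have hpos : (0 : ℝ) < M := by exact_mod_cast hM
  -- Here `B = 3 * M ^ 2` gives `(1 - 1/M) ^ B ≤ exp (-3M) ≤ 1/(3M)`.
  have h₃ : (M : ℝ) * (1 - 1 / (M : ℝ)) ^ B ≤ 1 / 3 := by
    have h₀ : 0 ≤ 1 - 1 / (M : ℝ) := by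
      rw [sub_nonneg, div_le_one hpos]
      exact_mod_cast hM
    have ha : (1 - 1 / (M : ℝ)) ^ B ≤ Real.exp (-(3 * M)) := by
      calc (1 - 1 / (M : ℝ)) ^ B ≤ Real.exp (-(1 / (M : ℝ))) ^ B :=
            pow_le_pow_left₀ h₀ (Real.one_sub_le_exp_neg _) _
        _ = Real.exp (-(3 * M)) := by
            rw [← Real.exp_nat_mul, hB]
            congr 1
            push_cast
            field_simp
    have hb : 3 * (M : ℝ) ≤ Real.exp (3 * M) := by
      have := Real.add_one_le_exp (3 * (M : ℝ))
      linarith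
    rw [Real.exp_neg] at ha
    calc (M : ℝ) * (1 - 1 / (M : ℝ)) ^ B ≤ M * (3 * (M : ℝ))⁻¹ := by
          gcongr
          exact ha.trans (inv_anti₀ (by positivity) hb)
      _ = 1 / 3 := by field_simp
  have h₄ : (sampleLaw D (M * B)).real Gᶜ ≤ 1 / 3 := by
    refine (measureReal_mono hsub).trans ((measureReal_union_le _ _).trans ?_)
    have h₅ : (sampleLaw D (M * B)).real
        (⋃ i, {s : Fin (M * B) → Fin n → Bool | s i ∉ Set.range code}) = 0 := by
      rw [measureReal_eq_zero_iff, measure_iUnion_null_iff]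
      exact h₁
    have h₆ : (sampleLaw D (M * B)).real
        (⋃ j, {s | ∀ t, s (finProdFinEquiv (j, t)) ≠ code j}) ≤ M * (1 - 1 / (M : ℝ)) ^ B := by
      refine (measureReal_iUnion_fintype_le _).trans ((Finset.sum_le_sum fun j _ => h₂ j).trans ?_)
      simp
    linarith
  have h₇ : 2 / 3 ≤ (sampleLaw D (M * B)).real G := by
    rw [probReal_compl_eq_one_sub (hmeas G)] at h₄
    linarith
  have := ENNReal.ofReal_le_ofReal h₇
  rw [ofReal_measureReal] at this
  refine le_trans (le_of_eq ?_) this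
  rw [ENNReal.ofReal_div_of_pos (by norm_num)]
  simp

/-! ### The main theorem -/

theorem exists_forall_polynomial_eval_le (q : Polynomial ℕ) :
    ∃ n₀, 1 ≤ n₀ ∧ ∀ n ≥ n₀, q.eval n < 2 ^ (n - 1) := by
  have h : (fun n : ℕ => ((q.eval n : ℕ) : ℝ)) =o[Filter.atTop] fun n => (2 : ℝ) ^ n := by
    induction q using Polynomial.induction_on' with
    | add p q hp hq => simpa using hp.add hq
    | monomial k c =>
      simpa using (isLittleO_pow_const_const_pow_of_one_lt (R := ℝ) k one_lt_two).const_mul_left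
        (c : ℝ)
  -- The constant 1/4 pays for the shift from `2 ^ n` to `2 ^ (n - 1)` and leaves a strict
  -- inequality.
  have h' := h.def (show (0 : ℝ) < 1 / 4 by norm_num)
  obtain ⟨N, hN⟩ := Filter.eventually_atTop.1 h'
  refine ⟨N + 1, by omega, fun n hn => ?_⟩
  obtain ⟨k, rfl⟩ : ∃ k, n = k + 1 := ⟨n - 1, by omega⟩
  have := hN (k + 1) (by omega)
  rw [Real.norm_natCast, Real.norm_of_nonneg (by positivity), pow_succ] at this
  have h2 : (0 : ℝ) < 2 ^ k := by positivity
  have h3 : ((q.eval (k + 1) : ℕ) : ℝ) < ((2 ^ k : ℕ) : ℝ) := by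
    push_cast
    linarith
  simpa using (by exact_mod_cast h3 : q.eval (k + 1) < 2 ^ k)

/-- The automaton that remembers words of length less than `n`. -/
def remember (n : ℕ) (s : Option {l : List Bool // l.length < n}) (b : Bool) :
    Option {l : List Bool // l.length < n} :=
  s.bind fun l => if h : (l.1 ++ [b]).length < n then some ⟨l.1 ++ [b], h⟩ else none

theorem foldl_remember {n : ℕ} (hn : 0 < n) (x : List Bool) :
    x.foldl (remember n) (some ⟨[], hn⟩) = if h : x.length < n then some ⟨x, h⟩ else none := by
  induction x using List.reverseRecOn with
  | nil => simp [hn]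
  | append_singleton x b ih =>
    rw [List.foldl_append, ih, List.foldl_cons, List.foldl_nil]
    by_cases h : x.length < n
    · simp [h, remember]
    · have : ¬ (x ++ [b]).length < n := by simp; omega
      simp only [h, this, dif_neg, not_false_eq_true]
      rfl

theorem le_measure_prod_of_le {α β : Type*} [MeasurableSpace α] [MeasurableSpace β]
    {μ : Measure α} {ν : Measure β} [SFinite μ] [IsProbabilityMeasure ν] {G : Set α}
    {E : Set (α × β)} {c : ENNReal} (h : c ≤ μ G) (hE : ∀ s ∈ G, ∀ r, (s, r) ∈ E) :
    c ≤ (μ.prod ν) E := by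
  have : (μ.prod ν) (G ×ˢ Set.univ) = μ G := by rw [Measure.prod_prod, measure_univ, mul_one]
  exact h.trans (this ▸ measure_mono fun ω hω => hE ω.1 hω.1 ω.2)

theorem pPoly_subset_bppSamp : PPoly ⊆ BPPSamp := by
  rintro L ⟨g, hg, a, q, ha, hga⟩
  -- From `n₀` on, the dummy index `q(n) + 1` fits into `n - 1` digits.
  obtain ⟨n₀, hn₀, hq⟩ := exists_forall_polynomial_eval_le (q + 1)
  have : Finite {l : List Bool // l.length < n₀} := List.finite_length_lt Bool n₀
  have : Fintype (Option {l : List Bool // l.length < n₀}) := Fintype.ofFinite _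
  refine ⟨_, gatherFun_computable (δ := remember n₀)
    (out := Option.map fun l => indicator L l.1) (q₀ := some ⟨[], hn₀⟩) hg, ?_⟩
  have hshort : ∀ (x : List Bool) (es : List (List Bool × Bool)), x.length < n₀ →
      gatherFun g (remember n₀) (Option.map fun l => indicator L l.1) (some ⟨[], hn₀⟩) (x, es) =
        indicator L x := by
    intro x es hx
    simp [gatherFun, foldl_remember, hx]
  have hlong : ∀ (x : List Bool) (es : List (List Bool × Bool)), ¬ x.length < n₀ →
      gatherFun g (remember n₀) (Option.map fun l => indicator L l.1) (some ⟨[], hn₀⟩) (x, es) =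
        g (x, (es.foldl gather (List.replicate (x.length - 1) false, [])).2.reverse) := by
    intro x es hx
    simp [gatherFun, foldl_remember, hx]
  let code : (n : ℕ) → Fin (q.eval n + 1) → Fin n → Bool := fun n j i =>
    (codeword (n - 1) (q.eval n + 1) (a n) j).getD i false
  let D : (n : ℕ) → PMF (Fin n → Bool) := fun n => (PMF.uniformOfFintype _).map (code n)
  refine ⟨D, (q + 1) * (3 * (q + 1) ^ 2), fun x => ?_⟩
  by_cases hx : x.length < n₀
  · simp only [hshort x _ hx]
    simp only [Set.ofPred_true, measure_univ]
    exact ENNReal.div_le_of_le_mul (by norm_num)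
  · obtain ⟨n, hn⟩ : ∃ n, n = x.length := ⟨_, rfl⟩
    obtain ⟨k, rfl⟩ : ∃ k, n = k + 1 := ⟨n - 1, by omega⟩
    have hN := hq (k + 1) (by omega)
    simp only [Polynomial.eval_add, Polynomial.eval_one, Nat.add_sub_cancel] at hN
    have hp : ((q + 1) * (3 * (q + 1) ^ 2)).eval x.length =
        (q.eval (k + 1) + 1) * (3 * (q.eval (k + 1) + 1) ^ 2) := by
      rw [← hn]
      simp
    have hhit := le_sampleLaw_hit (n := k + 1) (M := q.eval (k + 1) + 1) (Nat.succ_pos _) rfl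
      (D (k + 1)) (code (k + 1)) ?_ ?_
    · rw [hp, ← hn]
      refine le_measure_prod_of_le hhit fun s ⟨h₁, h₂⟩ r => ?_
      rw [Set.mem_ofPred_eq, hlong x _ hx, ← hn, Nat.add_sub_cancel]
      rw [foldl_gather_trainingSet L (a := a (k + 1)) hN
        (Nat.lt_succ_of_le (ha _)) ((ha _).trans (Nat.le_succ _))
        (fun j => ofFn_getD (length_codeword _ _ _ _)) h₁ h₂, hn, hga]
    · intro j
      rw [PMF.map_apply]
      -- Only a lower bound: dummy codewords may coincide, and their masses then add up.
      refine le_trans ?_ (ENNReal.le_tsum j)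
      simp
    · intro y hy
      rw [PMF.support_map] at hy
      obtain ⟨j, -, rfl⟩ := hy
      exact ⟨j, rfl⟩

end SamplingAdvice

theorem theorem1 :
    SamplingAdvice.PPoly ⊆ SamplingAdvice.BPPSamp ∧
      SamplingAdvice.PPoly = SamplingAdvice.BPPSamp :=
  ⟨SamplingAdvice.pPoly_subset_bppSamp, SamplingAdvice.pPoly_subset_bppSamp.antisymm
    SamplingAdvice.bppSamp_subset_pPoly⟩
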